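/- Let $q\in\mathbb C\setminus\{0\}$ with $|q|<1$. Call $S\subseteq\mathbb C$ $q$-spiraling if $0\in S$ and $q^nx\in S$ for all $x\in S$, $n\ge 0$. The $\mathfrak q$-topology on $\mathbb C$ has as open sets $\varnothing$ and the $q$-spiraling sets that are open in the usual topology; the $\mathfrak d$-topology has as open sets $\varnothing$, $\mathbb C$ and the open disks centered at $0$. Let $\mathbb C_{xy}=\mathbb C_x\cup\mathbb C_y\subseteq\mathbb C^2$ with $\mathbb C_x=\mathbb C\times\{0\}$ and $\mathbb C_y=\{0\}\times\mathbb C$, endowed with the $(\mathfrak q,\mathfrak d)$-topology, the final topology for the embeddings of $(\mathbb C_x,\mathfrak q)$ and $(\mathbb C_y,\mathfrak d)$. Let $U\subseteq\mathbb C_{xy}$ be $(\mathfrak q,\mathfrak d)$-open, $U_x=U\cap\mathbb C_x$ and $U_y=U\cap\mathbb C_y$, regarded as subsets of $\mathbb C$. For an open $V\subseteq\mathbb C$ let $\mathcal O(V)$ be the algebra of holomorphic functions on $V$ with the topology of uniform convergence on compact sets. Let $\mathcal O_q(U)$ be the space of all series $f=\sum_{n\ge0}f_n(x)y^n$ with $f_n\in\mathcal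 O(U_x)$ such that $$p_{K,\rho}(f)=\sum_n\|f_n\|_K\,\rho^n<\infty$$ for all compact $K\subseteq U_x$ and all $\rho\ge 0$ with $\rho\in U_y$ (here $\|f_n\|_K=\sup_K|f_n|$), with the topology given by the seminorms $p_{K,\rho}$ and the multiplication $$f\cdot g=\sum_n\Big(\sum_{i+j=n}f_i(x)\,g_j(q^ix)\Big)y^n .$$ Let $\operatorname{Rad}\mathcal O_q(U)$ be the Jacobson radical of $\mathcal O_q(U)$, $\operatorname{Spec}\mathcal O_q(U)$ the set of its continuous (unital) characters, $\mathcal O^{\mathfrak q}(U_x)=\mathcal O(U_x)$, and $\mathcal I_{\mathfrak d}(U_y)=\{b\in\mathcal O(U_y): b(0)=0\}$ (for $U=\varnothing$ all these algebras are $\{0\}$). Then the following hold. 1. $\mathcal O_q(U)$ is a Fréchet algebra (a complete metrizable locally convex space with jointly continuous multiplication). The maps $\iota_x(a)=a(x)y^0$ and $\iota_y(b)=\sum_n b_ny^n$, where $b(w)=\sum_n b_nw^n$ on $U_y$, are unital algebra homomorphisms $\iota_x:\mathcal O(U_x)\to\mathcal O_q(U)$ and $\iota_y:\mathcal O(U_y)\to\mathcal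 O_q(U)$, and $\mathcal O_q(U)$ with the bilinear map $(a,b)\mapsto\iota_x(a)\iota_y(b)=\sum_n b_na(x)y^n$ is the completed projective tensor product $\mathcal O(U_x)\widehat\otimes\mathcal O(U_y)$. 2. $\iota_x(\mathcal O^{\mathfrak q}(U_x))$, $\operatorname{Rad}\mathcal O_q(U)$ and $\iota_y(\mathcal I_{\mathfrak d}(U_y))$ are closed subalgebras of $\mathcal O_q(U)$, and there is a topological direct sum decomposition $$\mathcal O_q(U)=\mathcal O^{\mathfrak q}(U_x)\oplus\operatorname{Rad}\mathcal O_q(U)\oplus\mathcal I_{\mathfrak d}(U_y),$$ that is, $(a,r,b)\mapsto\iota_x(a)+r+\iota_y(b)$ is a linear homeomorphism from $\mathcal O^{\mathfrak q}(U_x)\times\operatorname{Rad}\mathcal O_q(U)\times\mathcal I_{\mathfrak d}(U_y)$ onto $\mathcal O_q(U)$. 3. $\operatorname{Rad}\mathcal O_q(U)$ consists exactly of the series $\sum_{n\ge1}f_n(x)y^n\in\mathcal O_q(U)$ with $f_n(0)=0$ for all $n\ge 1$. 4. $\mathcal O_q(U)$ is commutative modulo its Jacobson radical: $fg-gf\in\operatorname{Rad}\mathcal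 O_q(U)$ for all $f,g\in\mathcal O_q(U)$. 5. $\operatorname{Spec}\mathcal O_q(U)=U$: sending $\gamma=(\lambda,\mu)\in U$ to $f\mapsto\sum_n f_n(\lambda)\mu^n$ (with $0^0=1$) is a bijection from $U$ onto the set of continuous characters of $\mathcal O_q(U)$. -/

import Mathlib

open TopologicalSpace Topology

universe u

noncomputable section

namespace QPlaneSheaf

/-! ## The `q`-topology, the disk topology, and the space `ℂ_xy` -/

/-- A `q`-spiraling set contains the origin and, with each `x`, all points `q ^ n * x`. -/
def IsSpiraling (q : ℂ) (S : Set ℂ) : Prop :=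
  (0 : ℂ) ∈ S ∧ ∀ x ∈ S, ∀ n : ℕ, q ^ n * x ∈ S

/-- The `q`-topology on `ℂ`: the open sets are the empty set and the `q`-spiraling sets which are
open in the standard topology. -/
@[reducible] def qTopology (q : ℂ) : TopologicalSpace ℂ where
  IsOpen S := IsOpen S ∧ (S = ∅ ∨ IsSpiraling q S)
  isOpen_univ := ⟨isOpen_univ, Or.inr ⟨trivial, fun _ _ _ => trivial⟩⟩
  isOpen_inter := by
    rintro S T ⟨hS, hS'⟩ ⟨hT, hT'⟩
    refine ⟨hS.inter hT, ?_⟩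
    rcases hS' with rfl | hS'
    · left; simp
    rcases hT' with rfl | hT'
    · left; simp
    exact Or.inr ⟨⟨hS'.1, hT'.1⟩, fun x hx n => ⟨hS'.2 x hx.1 n, hT'.2 x hx.2 n⟩⟩
  isOpen_sUnion := by
    intro C hC
    refine ⟨isOpen_sUnion fun S hS => (hC S hS).1, ?_⟩
    rcases Set.eq_empty_or_nonempty (⋃₀ C) with h | ⟨x, S, hS, hx⟩
    · exact Or.inl h
    refine Or.inr ⟨?_, ?_⟩
    · rcases (hC S hS).2 with rfl | h
      · exact absurd hx (Set.notMem_empty x)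
      · exact ⟨S, hS, h.1⟩
    · rintro z ⟨T, hT, hz⟩ n
      rcases (hC T hT).2 with rfl | h
      · exact absurd hz (Set.notMem_empty z)
      · exact ⟨T, hT, h.2 z hz n⟩

/-- The disk topology on `ℂ`: the open sets are `∅`, `ℂ` and the open disks centered at the origin
(that is, the balls of radius `r ∈ [0, ∞]`). -/
@[reducible] def diskTopology : TopologicalSpace ℂ where
  IsOpen S := ∃ r : ENNReal, S = Metric.eball 0 r
  isOpen_univ := ⟨⊤, by ext z; simp⟩
  isOpen_inter := by
    rintro S T ⟨r, rfl⟩ ⟨s, rfl⟩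
    exact ⟨min r s, by ext z; simp [Metric.mem_eball]⟩
  isOpen_sUnion := by
    intro C hC
    choose! r hr using hC
    refine ⟨⨆ S ∈ C, r S, ?_⟩
    ext z
    simp only [Set.mem_sUnion, Metric.mem_eball, lt_iSup_iff]
    constructor
    · rintro ⟨S, hS, hz⟩
      rw [hr S hS] at hz
      exact ⟨S, hS, hz⟩
    · rintro ⟨S, hS, hz⟩
      refine ⟨S, hS, ?_⟩
      rw [hr S hS]
      exact hz

/-- The union `ℂ_xy` of the two coordinate axes `ℂ_x = ℂ × {0}` and `ℂ_y = {0} × ℂ` in `ℂ²`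
(the parameter `q` records the topology put on it). -/
def QPlane (_q : ℂ) : Type := {p : ℂ × ℂ // p.2 = 0 ∨ p.1 = 0}

variable {q : ℂ}

/-- The embedding of `ℂ_x`. -/
def inX (q : ℂ) (z : ℂ) : QPlane q := ⟨(z, 0), Or.inl rfl⟩

/-- The embedding of `ℂ_y`. -/
def inY (q : ℂ) (w : ℂ) : QPlane q := ⟨(0, w), Or.inr rfl⟩

/-- The `(𝔮, 𝔡)`-topology: the final topology for the embeddings of `ℂ_x` with the `q`-topology
and of `ℂ_y` with the disk topology. -/
instance : TopologicalSpace (QPlane q) :=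
  (qTopology q).coinduced (inX q) ⊔ diskTopology.coinduced (inY q)

/-- `U_x = U ∩ ℂ_x`, as a subset of `ℂ`. -/
def Ux (U : Opens (QPlane q)) : Set ℂ := inX q ⁻¹' U

/-- `U_y = U ∩ ℂ_y`, as a subset of `ℂ`. -/
def Uy (U : Opens (QPlane q)) : Set ℂ := inY q ⁻¹' U

theorem isOpen_Ux (U : Opens (QPlane q)) : IsOpen[qTopology q] (Ux U) := by
  have h := U.isOpen
  exact (isOpen_coinduced (t := qTopology q)).1 (isOpen_sup.1 h).1

theorem isOpen_Uy (U : Opens (QPlane q)) : IsOpen[diskTopology] (Uy U) := by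
  have h := U.isOpen
  exact (isOpen_coinduced (t := diskTopology)).1 (isOpen_sup.1 h).2

theorem spiraling_of_mem (U : Opens (QPlane q)) {z : ℂ} (hz : z ∈ Ux U) :
    IsSpiraling q (Ux U) := by
  rcases (isOpen_Ux U).2 with h | h
  · rw [h] at hz; exact absurd hz (Set.notMem_empty z)
  · exact h

theorem fst_mem_Ux (U : Opens (QPlane q)) (γ : U) : γ.1.1.1 ∈ Ux U := by
  obtain ⟨⟨⟨a, b⟩, h⟩, hγ⟩ := γ
  rcases h with h | h
  · simp only at h; subst h; exact hγ
  · simp only at h; subst h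
    have hb : b ∈ Uy U := hγ
    obtain ⟨r, hr⟩ := isOpen_Uy U
    rw [hr, Metric.mem_eball] at hb
    have h0 : (0 : ℂ) ∈ Uy U := by
      rw [hr, Metric.mem_eball, edist_self]; exact lt_of_le_of_lt (zero_le) hb
    exact h0

/-! ## Holomorphic functions -/

/-- The algebra `𝒪(V)` of holomorphic functions on `V`, with the topology of uniform convergence
on compact subsets (the one it inherits from `C(V, ℂ)`). -/
def Hol (V : Set ℂ) : Subalgebra ℂ C(V, ℂ) where
  carrier := {f | ∃ F : ℂ → ℂ, DifferentiableOn ℂ F V ∧ ∀ z : V, f z = F z}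
  mul_mem' := by
    rintro f g ⟨F, hF, hf⟩ ⟨G, hG, hg⟩
    exact ⟨F * G, hF.mul hG, fun z => by simp [hf, hg]⟩
  add_mem' := by
    rintro f g ⟨F, hF, hf⟩ ⟨G, hG, hg⟩
    exact ⟨F + G, hF.add hG, fun z => by simp [hf, hg]⟩
  algebraMap_mem' c := ⟨fun _ => c, differentiableOn_const c, fun _ => rfl⟩

/-- The ideal of those holomorphic functions on `V` that vanish at the origin. -/
def holVanish (V : Set ℂ) : Ideal (Hol V) where
  carrier := {f | ∀ z : V, (z : ℂ) = 0 → f.1 z = 0}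
  add_mem' := by
    intro f g hf hg z hz
    simp [hf z hz, hg z hz]
  zero_mem' := fun _ _ => rfl
  smul_mem' := by
    intro c f hf z hz
    simp [hf z hz]

/-- The norm `‖f‖_K = sup_K |f|`. -/
def supNorm {V : Set ℂ} (K : Compacts V) (f : Hol V) : ℝ := ‖f.1.restrict (K : Set V)‖

theorem supNorm_nonneg {V : Set ℂ} (K : Compacts V) (f : Hol V) : 0 ≤ supNorm K f :=
  norm_nonneg _

theorem supNorm_add_le {V : Set ℂ} (K : Compacts V) (f g : Hol V) :
    supNorm K (f + g) ≤ supNorm K f + supNorm K g :=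
  norm_add_le (f.1.restrict (K : Set V)) (g.1.restrict (K : Set V))

theorem supNorm_mul_le {V : Set ℂ} (K : Compacts V) (f g : Hol V) :
    supNorm K (f * g) ≤ supNorm K f * supNorm K g :=
  norm_mul_le (f.1.restrict (K : Set V)) (g.1.restrict (K : Set V))

theorem supNorm_smul {V : Set ℂ} (K : Compacts V) (c : ℂ) (f : Hol V) :
    supNorm K (c • f) = ‖c‖ * supNorm K f :=
  norm_smul c (f.1.restrict (K : Set V))

theorem supNorm_zero {V : Set ℂ} (K : Compacts V) : supNorm K (0 : Hol V) = 0 :=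
  norm_zero (E := C((K : Set V), ℂ))

theorem supNorm_sum_le {V : Set ℂ} (K : Compacts V) {ι : Type*} (s : Finset ι) (f : ι → Hol V) :
    supNorm K (∑ i ∈ s, f i) ≤ ∑ i ∈ s, supNorm K (f i) := by
  classical
  induction s using Finset.induction_on with
  | empty => simp [supNorm_zero]
  | insert a s ha ih =>
    rw [Finset.sum_insert ha, Finset.sum_insert ha]
    exact (supNorm_add_le K _ _).trans (by gcongr)

/-- Multiplication by `q ^ i` on `U_x`. -/
def scaleMap (U : Opens (QPlane q)) (i : ℕ) : C(Ux U, Ux U) where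
  toFun z := ⟨q ^ i * z, (spiraling_of_mem U z.2).2 z z.2 i⟩

/-- The endomorphism `f(x) ↦ f(q ^ i x)` of `𝒪(U_x)`. -/
def scale (U : Opens (QPlane q)) (i : ℕ) : Hol (Ux U) →ₐ[ℂ] Hol (Ux U) where
  toFun f := ⟨f.1.comp (scaleMap U i), by
    obtain ⟨F, hF, hf⟩ := f.2
    refine ⟨fun z => F (q ^ i * z), ?_, fun z => hf _⟩
    exact hF.comp (by fun_prop) (fun z hz => (spiraling_of_mem U hz).2 z hz i)⟩
  map_one' := rfl
  map_mul' _ _ := rfl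
  map_zero' := rfl
  map_add' _ _ := rfl
  commutes' _ := rfl

theorem scale_zero (U : Opens (QPlane q)) (f : Hol (Ux U)) : scale U 0 f = f := by
  apply Subtype.ext
  ext z
  change f.1 (scaleMap U 0 z) = f.1 z
  congr 1
  apply Subtype.ext
  simp [scaleMap]

theorem scale_scale (U : Opens (QPlane q)) (i j : ℕ) (f : Hol (Ux U)) :
    scale U i (scale U j f) = scale U (i + j) f := by
  apply Subtype.ext
  ext z
  change f.1 (scaleMap U j (scaleMap U i z)) = f.1 (scaleMap U (i + j) z)
  congr 1
  apply Subtype.ext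
  simp only [scaleMap, ContinuousMap.coe_mk]
  ring

/-! ## Formal series with the `q`-multiplication -/

/-- The formal series `∑ fₙ(x) yⁿ` with coefficients `fₙ ∈ 𝒪(U_x)`. -/
def QSeries (U : Opens (QPlane q)) : Type := ℕ → Hol (Ux U)

namespace QSeries

variable {U : Opens (QPlane q)}

/-- The coefficient `fₙ` of `f = ∑ fₙ(x) yⁿ`. -/
def coeff (f : QSeries U) (n : ℕ) : Hol (Ux U) := f n

@[ext] theorem ext {f g : QSeries U} (h : ∀ n, coeff f n = coeff g n) : f = g := funext h

instance : AddCommGroup (QSeries U) := inferInstanceAs (AddCommGroup (ℕ → Hol (Ux U)))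
instance : Module ℂ (QSeries U) := inferInstanceAs (Module ℂ (ℕ → Hol (Ux U)))

/-- The formal `q`-multiplication `f · g = ∑ₙ (∑_{i + j = n} fᵢ(x) gⱼ(qⁱ x)) yⁿ`. -/
instance : Mul (QSeries U) :=
  ⟨fun f g n => ∑ p ∈ Finset.HasAntidiagonal.antidiagonal n, coeff f p.1 * scale U p.1 (coeff g p.2)⟩

instance : One (QSeries U) := ⟨fun n => if n = 0 then 1 else 0⟩

@[simp] theorem coeff_zero (n : ℕ) : coeff (0 : QSeries U) n = 0 := rfl
@[simp] theorem coeff_add (f g : QSeries U) (n : ℕ) : coeff (f + g) n = coeff f n + coeff g n := rfl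
@[simp] theorem coeff_smul (c : ℂ) (f : QSeries U) (n : ℕ) : coeff (c • f) n = c • coeff f n := rfl
theorem coeff_one (n : ℕ) : coeff (1 : QSeries U) n = if n = 0 then 1 else 0 := rfl
theorem coeff_mul (f g : QSeries U) (n : ℕ) : coeff (f * g) n =
    ∑ p ∈ Finset.HasAntidiagonal.antidiagonal n, coeff f p.1 * scale U p.1 (coeff g p.2) := rfl

protected theorem one_mul (f : QSeries U) : 1 * f = f := by
  ext1 n
  rw [coeff_mul, Finset.sum_eq_single (0, n)]
  · simp [coeff_one, scale_zero]
  · rintro ⟨i, j⟩ hp hne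
    have hi : i ≠ 0 := by
      rintro rfl
      simp only [Finset.HasAntidiagonal.mem_antidiagonal, zero_add] at hp
      exact hne (by rw [hp])
    simp [coeff_one, hi]
  · simp

protected theorem mul_one (f : QSeries U) : f * 1 = f := by
  ext1 n
  rw [coeff_mul, Finset.sum_eq_single (n, 0)]
  · simp [coeff_one]
  · rintro ⟨i, j⟩ hp hne
    have hi : j ≠ 0 := by
      rintro rfl
      simp only [Finset.HasAntidiagonal.mem_antidiagonal, add_zero] at hp
      exact hne (by rw [hp])
    simp [coeff_one, hi]
  · simp

protected theorem mul_assoc (f g h : QSeries U) : f * g * h = f * (g * h) := by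
  ext1 n
  simp only [coeff_mul, Finset.sum_mul, map_sum, map_mul, Finset.mul_sum, scale_scale]
  rw [Finset.sum_sigma', Finset.sum_sigma']
  refine Finset.sum_nbij' (fun p => ⟨(p.2.1, p.2.2 + p.1.2), (p.2.2, p.1.2)⟩)
    (fun p => ⟨(p.1.1 + p.2.1, p.2.2), (p.1.1, p.2.1)⟩) ?_ ?_ ?_ ?_ ?_
  · rintro ⟨⟨a, b⟩, ⟨c, d⟩⟩ hp
    simp only [Finset.mem_sigma, Finset.HasAntidiagonal.mem_antidiagonal] at hp ⊢
    obtain ⟨rfl, rfl⟩ := hp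
    simp [add_assoc]
  · rintro ⟨⟨a, b⟩, ⟨c, d⟩⟩ hp
    simp only [Finset.mem_sigma, Finset.HasAntidiagonal.mem_antidiagonal] at hp ⊢
    obtain ⟨rfl, rfl⟩ := hp
    simp [add_assoc]
  · rintro ⟨⟨a, b⟩, ⟨c, d⟩⟩ hp
    simp only [Finset.mem_sigma, Finset.HasAntidiagonal.mem_antidiagonal] at hp
    obtain ⟨rfl, rfl⟩ := hp
    rfl
  · rintro ⟨⟨a, b⟩, ⟨c, d⟩⟩ hp
    simp only [Finset.mem_sigma, Finset.HasAntidiagonal.mem_antidiagonal] at hp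
    obtain ⟨rfl, rfl⟩ := hp
    rfl
  · rintro ⟨⟨a, b⟩, ⟨c, d⟩⟩ hp
    simp only [Finset.mem_sigma, Finset.HasAntidiagonal.mem_antidiagonal] at hp
    obtain ⟨rfl, rfl⟩ := hp
    simp only [mul_assoc]

instance : Ring (QSeries U) :=
  { (inferInstance : AddCommGroup (QSeries U)) with
    mul := (· * ·)
    one := 1
    one_mul := QSeries.one_mul
    mul_one := QSeries.mul_one
    mul_assoc := QSeries.mul_assoc
    zero_mul := fun f => by ext1 n; simp [coeff_mul]
    mul_zero := fun f => by ext1 n; simp [coeff_mul]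
    left_distrib := fun f g h => by
      ext1 n; simp [coeff_mul, mul_add, Finset.sum_add_distrib]
    right_distrib := fun f g h => by
      ext1 n; simp [coeff_mul, add_mul, Finset.sum_add_distrib] }

instance : Algebra ℂ (QSeries U) :=
  Algebra.ofModule
    (fun c f g => by ext1 n; simp [coeff_mul, Finset.smul_sum])
    (fun c f g => by ext1 n; simp [coeff_mul, Finset.smul_sum])

end QSeries

/-! ## The algebra `𝒪_q(U)` -/

/-- The radii `ρ ≥ 0` that are smaller than the radius of the disk `U_y`. -/
def Radius (U : Opens (QPlane q)) : Type := {ρ : NNReal // ((ρ : ℝ) : ℂ) ∈ Uy U}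

/-- Every compact subset of `U_x` is carried by all the maps `x ↦ qⁱ x` into one compact subset. -/
theorem exists_hull (hq : ‖q‖ < 1) (U : Opens (QPlane q)) (K : Compacts (Ux U)) :
    ∃ L : Compacts (Ux U), ∀ (i : ℕ) (f : Hol (Ux U)), supNorm K (scale U i f) ≤ supNorm L f := by
  have h1 : IsCompact (insert (0 : ℂ) (Set.range fun n : ℕ => q ^ n)) :=
    (tendsto_pow_atTop_nhds_zero_of_norm_lt_one hq).isCompact_insert_range
  have h2 : IsCompact (Subtype.val '' (K : Set (Ux U))) := K.isCompact.image continuous_subtype_val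
  have h3 := (h1.prod h2).image continuous_mul
  have hsub : (fun p : ℂ × ℂ => p.1 * p.2) '' ((insert (0 : ℂ) (Set.range fun n : ℕ => q ^ n)) ×ˢ
      (Subtype.val '' (K : Set (Ux U)))) ⊆ Ux U := by
    rintro _ ⟨⟨t, z⟩, ⟨ht, ⟨z, hz, rfl⟩⟩, rfl⟩
    have hs := spiraling_of_mem U z.2
    rcases ht with ht | ⟨n, ht⟩
    · simp only at ht
      simpa [ht] using hs.1
    · simp only at ht
      simpa [← ht] using hs.2 z z.2 n
  obtain ⟨L, hL⟩ : ∃ L : Compacts (Ux U), ∀ (i : ℕ), ∀ z ∈ K, scaleMap U i z ∈ L := by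
    refine ⟨⟨_, IsEmbedding.subtypeVal.isCompact_preimage_iff (by simpa using hsub) |>.2 h3⟩, ?_⟩
    intro i z hz
    exact ⟨(q ^ i, z), ⟨Or.inr ⟨i, rfl⟩, ⟨z, hz, rfl⟩⟩, rfl⟩
  refine ⟨L, fun i f => ?_⟩
  unfold supNorm
  rw [ContinuousMap.norm_le _ (norm_nonneg _)]
  intro z
  exact ContinuousMap.norm_coe_le_norm (f.1.restrict (L : Set (Ux U)))
    ⟨scaleMap U i z.1, hL i z.1 z.2⟩

/-- The condition `p_{K,ρ}(f) = ∑ ‖fₙ‖_K ρⁿ < ∞` for all compact `K ⊆ U_x` and all radii `ρ`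
smaller than that of `U_y`. -/
def IsAbsConv {U : Opens (QPlane q)} (f : QSeries U) : Prop :=
  ∀ (K : Compacts (Ux U)) (ρ : Radius U), Summable fun n : ℕ => supNorm K (f.coeff n) * (ρ.1 : ℝ) ^ n

theorem IsAbsConv.add {U : Opens (QPlane q)} {f g : QSeries U} (hf : IsAbsConv f)
    (hg : IsAbsConv g) : IsAbsConv (f + g) := by
  intro K ρ
  refine Summable.of_nonneg_of_le
    (fun n => mul_nonneg (supNorm_nonneg _ _) (by positivity)) (fun n => ?_)
    ((hf K ρ).add (hg K ρ))
  rw [QSeries.coeff_add, ← add_mul]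
  exact mul_le_mul_of_nonneg_right (supNorm_add_le K _ _) (by positivity)

theorem summable_aux {a b c : ℕ → ℝ} {r : ℝ} (hr : 0 ≤ r) (ha : ∀ n, 0 ≤ a n) (hb : ∀ n, 0 ≤ b n)
    (hc : ∀ n, 0 ≤ c n) (hA : Summable fun n => a n * r ^ n) (hB : Summable fun n => b n * r ^ n)
    (h : ∀ n, c n ≤ ∑ p ∈ Finset.HasAntidiagonal.antidiagonal n, a p.1 * b p.2) :
    Summable fun n => c n * r ^ n := by
  have h1 : Summable fun x : ℕ × ℕ => (a x.1 * r ^ x.1) * (b x.2 * r ^ x.2) :=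
    hA.mul_of_nonneg hB (fun n => mul_nonneg (ha n) (pow_nonneg hr n))
      (fun n => mul_nonneg (hb n) (pow_nonneg hr n))
  have h2 := summable_sum_mul_antidiagonal_of_summable_mul (A := ℕ)
    (f := fun n => a n * r ^ n) (g := fun n => b n * r ^ n) h1
  refine Summable.of_nonneg_of_le (fun n => mul_nonneg (hc n) (by positivity)) (fun n => ?_) h2
  refine (mul_le_mul_of_nonneg_right (h n) (by positivity)).trans_eq ?_
  rw [Finset.sum_mul]
  refine Finset.sum_congr rfl fun p hp => ?_
  rw [← Finset.HasAntidiagonal.mem_antidiagonal.1 hp, pow_add]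
  ring

theorem IsAbsConv.mul (hq : ‖q‖ < 1) {U : Opens (QPlane q)} {f g : QSeries U} (hf : IsAbsConv f)
    (hg : IsAbsConv g) : IsAbsConv (f * g) := by
  intro K ρ
  obtain ⟨L, hL⟩ := exists_hull hq U K
  refine summable_aux ρ.1.2 (fun n => supNorm_nonneg K (f.coeff n))
    (fun n => supNorm_nonneg L (g.coeff n)) (fun n => supNorm_nonneg K _) (hf K ρ) (hg L ρ)
    (fun n => ?_)
  rw [QSeries.coeff_mul]
  refine (supNorm_sum_le K _ _).trans (Finset.sum_le_sum fun p _ => ?_)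
  exact (supNorm_mul_le K _ _).trans (mul_le_mul_of_nonneg_left (hL _ _) (supNorm_nonneg _ _))

theorem IsAbsConv.algebraMap (U : Opens (QPlane q)) (c : ℂ) :
    IsAbsConv (algebraMap ℂ (QSeries U) c) := by
  intro K ρ
  refine summable_of_ne_finset_zero (s := {0}) fun n hn => ?_
  rw [Algebra.algebraMap_eq_smul_one, QSeries.coeff_smul, QSeries.coeff_one,
    if_neg (by simpa using hn)]
  simp [supNorm_zero]

/-- The series `f = ∑ fₙ(x) yⁿ` with `p_{K,ρ}(f) < ∞` for all `K` and `ρ` form an algebra for the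
formal `q`-multiplication. -/
def oqSubalgebra (hq : ‖q‖ < 1) (U : Opens (QPlane q)) : Subalgebra ℂ (QSeries U) where
  carrier := {f | IsAbsConv f}
  mul_mem' hf hg := IsAbsConv.mul hq hf hg
  add_mem' hf hg := IsAbsConv.add hf hg
  algebraMap_mem' c := IsAbsConv.algebraMap U c

/-- The algebra `𝒪_q(U)`. -/
abbrev Oq (hq : ‖q‖ < 1) (U : Opens (QPlane q)) : Type := ↥(oqSubalgebra hq U)

/-- The seminorm `p_{K,ρ}(f) = ∑ ‖fₙ‖_K ρⁿ` on `𝒪_q(U)`. -/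
def oqSeminorm (hq : ‖q‖ < 1) (U : Opens (QPlane q)) (K : Compacts (Ux U)) (ρ : Radius U) :
    Seminorm ℂ (Oq hq U) :=
  Seminorm.of (fun f => ∑' n : ℕ, supNorm K (f.1.coeff n) * (ρ.1 : ℝ) ^ n)
    (fun f g => by
      have hfg := (f.2 K ρ).add (g.2 K ρ)
      rw [← (f.2 K ρ).tsum_add (g.2 K ρ)]
      refine ((f + g).2 K ρ).tsum_le_tsum (fun n => ?_) hfg
      rw [← add_mul]
      exact mul_le_mul_of_nonneg_right (supNorm_add_le K _ _) (by positivity))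
    (fun c f => by
      rw [← tsum_mul_left]
      refine tsum_congr fun n => ?_
      rw [← mul_assoc, ← supNorm_smul]
      rfl)

/-- `𝒪_q(U)` carries the locally convex (uniform) structure defined by the seminorms `p_{K,ρ}`. -/
instance (hq : ‖q‖ < 1) (U : Opens (QPlane q)) : UniformSpace (Oq hq U) :=
  ⨅ (i : Compacts (Ux U) × Radius U),
    (oqSeminorm hq U i.1 i.2).toSeminormedAddCommGroup.toUniformSpace

/-- A Fréchet algebra: a complete metrizable locally convex space with a jointly continuous
multiplication. -/
structure IsFrechetAlgebra (A : Type*) [Ring A] [Algebra ℂ A] [UniformSpace A] : Prop where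
  isUniformAddGroup : IsUniformAddGroup A
  continuousSMul : ContinuousSMul ℂ A
  polynormable : PolynormableSpace ℂ A
  complete : CompleteSpace A
  metrizable : MetrizableSpace A
  continuousMul : ContinuousMul A

/-- `G`, with the bilinear map `φ : E × F → G`, is the completed projective tensor product of the
topological vector spaces `E` and `F`: `φ` is jointly continuous, and each jointly continuous
bilinear map from `E × F` to a complete Hausdorff locally convex space `H` factors through `φ` by
exactly one continuous linear map `G → H`. (To be used for `G` complete, Hausdorff and locally
convex itself.) -/
structure IsCompletedProjectiveTensor {E F G : Type*}
    [AddCommMonoid E] [Module ℂ E] [TopologicalSpace E]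
    [AddCommMonoid F] [Module ℂ F] [TopologicalSpace F]
    [AddCommMonoid G] [Module ℂ G] [TopologicalSpace G] (φ : E →ₗ[ℂ] F →ₗ[ℂ] G) : Prop where
  continuous : Continuous fun p : E × F => φ p.1 p.2
  existsUnique_lift : ∀ (H : Type u) [AddCommGroup H] [Module ℂ H] [UniformSpace H]
    [IsUniformAddGroup H] [ContinuousSMul ℂ H] [PolynormableSpace ℂ H] [CompleteSpace H]
    [T2Space H] (B : E →ₗ[ℂ] F →ₗ[ℂ] H), Continuous (fun p : E × F => B p.1 p.2) →
    ∃! T : G →L[ℂ] H, ∀ e f, T (φ e f) = B e f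

/-- The bilinear map `(a, b) ↦ f(a) g(b)`. -/
def mulMap {A B C : Type*} [Semiring A] [Algebra ℂ A] [Semiring B] [Algebra ℂ B]
    [Semiring C] [Algebra ℂ C]
    (f : A →ₐ[ℂ] C) (g : B →ₐ[ℂ] C) : A →ₗ[ℂ] B →ₗ[ℂ] C :=
  (LinearMap.mul ℂ C).compl₁₂ f.toLinearMap g.toLinearMap

end QPlaneSheaf

end

open QPlaneSheaf

/-!
The algebra `𝒪_q(U)` is studied through its restrictions to the two axes. A series
`f = ∑ fₙ(x) yⁿ` restricts to `f₀ ∈ 𝒪(U_x)` on the `x`-axis and to `∑ fₙ(0) wⁿ ∈ 𝒪(U_y)` on the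
`y`-axis; both restrictions (`restrictX`, `restrictY`) are continuous homomorphisms, the second one
because the dilations `x ↦ qⁱ x` in the multiplication fix the origin. They are left inverse to the
embeddings `iotaX` and `iotaY`. That the Taylor series of a function on `U_y` lies in `𝒪_q(U)`
follows from Cauchy's estimates, as `U_y` is an open disk and has no largest radius.

*Radical.* The radical is the intersection of the kernels of the two restrictions
(`mem_jacobson_oq_iff`). It is contained in both kernels because point evaluations are characters.
Conversely let `g` vanish on both axes. Each compact subset of `U_x` lies in a compact `L` that is
invariant under the dilations. Since `g` has no term of degree zero in `y`, each factor of `gᵏ`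
pushes the argument of the next one into a smaller set, which gives
`p_{L,ρ}(gᵏ) ≤ ∏_{j < k} p_{qʲL,ρ}(g)` (`oqSeminorm_pow_le`). The coefficients of `g` vanish at the
origin and the sets `qʲL` shrink to it, so the factors tend to zero, the Neumann series of `g`
converges, and `1 - g` is invertible. As these `g` form an ideal, they are in the radical.
The description by coefficients, the closedness, the commutativity modulo the radical, and the
topological direct sum (`decomposition`) can be read off from the restrictions.

*Characters.* A character of `𝒪(V)` is the evaluation at its value on the coordinate function
(`character_eq_eval`). As the monomials `a(x) yⁿ` are total, a continuous character of `𝒪_q(U)` is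
determined by its values `λ ∈ U_x` on `x` and `μ ∈ U_y` on `y`. The relation
`y x = q x y` and `q ≠ 1` give `λ μ = 0`, so that `(λ, μ)` is a point of `U`.

*Tensor product.* A continuous bilinear map `B` on `𝒪(U_x) × 𝒪(U_y)` with values in a complete space
factors through `f ↦ ∑ B(fₙ, yⁿ)` (`lift`). This converges and is continuous because each seminorm
of `B(fₙ, yⁿ)` is bounded by a multiple of `‖fₙ‖_K ρⁿ`. The monomials `a(x) yⁿ` are total in
`𝒪_q(U)` (`hasSum_monomial`), and so are the powers of the coordinate in `𝒪(U_y)`, which gives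
uniqueness and the factorization.
-/

noncomputable section

namespace QPlaneSheaf

open Filter

/-! ### Spaces whose topology is defined by seminorms -/

/-- In a complete space whose topology is defined by seminorms, absolute convergence with respect
to each of them implies unconditional convergence. -/
theorem summable_of_summable_seminorm {E ι : Type*} [AddCommGroup E] [Module ℂ E] [UniformSpace E]
    [IsUniformAddGroup E] [CompleteSpace E] {p : SeminormFamily ℂ E ι} (hp : WithSeminorms p)
    {κ : Type*} {x : κ → E} (hx : ∀ i, Summable fun n => p i (x n)) : Summable x := by
  rw [summable_iff_vanishing]
  intro e he
  obtain ⟨s, r, hr, hs⟩ := (hp.mem_nhds_iff 0 e).1 he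
  have h1 : ∀ i, ∃ t : Finset κ, ∀ t', Disjoint t' t → p i (∑ b ∈ t', x b) < r := by
    intro i
    obtain ⟨t, ht⟩ := summable_iff_vanishing.1 (hx i) (Metric.ball 0 r) (Metric.ball_mem_nhds _ hr)
    refine ⟨t, fun t' h => ?_⟩
    have h2 := ht t' h
    rw [mem_ball_zero_iff, Real.norm_eq_abs] at h2
    refine lt_of_le_of_lt ?_ ((le_abs_self _).trans_lt h2)
    exact Finset.le_sum_of_subadditive (p i) (map_zero _).le (map_add_le_add _) _ _
  choose t ht using h1
  classical
  refine ⟨s.biUnion t, fun t' h => hs ?_⟩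
  rw [Seminorm.mem_ball, sub_zero]
  refine Seminorm.finset_sup_apply_lt hr fun i hi => ht i t' ?_
  exact h.mono_right (Finset.subset_biUnion_of_mem t hi)

theorem seminorm_le_tsum {E : Type*} [AddCommGroup E] [Module ℂ E] [TopologicalSpace E]
    {p : Seminorm ℂ E} (hp : Continuous p) {x : ℕ → E} {a : E} (hx : HasSum x a)
    (hs : Summable fun n => p (x n)) : p a ≤ ∑' n, p (x n) :=
  le_of_tendsto ((hp.tendsto a).comp hx) (Eventually.of_forall fun s =>
    (Finset.le_sum_of_subadditive p (map_zero _).le (map_add_le_add _) s x).trans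
      (hs.sum_le_tsum s fun _ _ => apply_nonneg _ _))

/-! ### The Fréchet space of holomorphic functions -/

section Hol

variable {V : Set ℂ}

instance (X : Type*) [TopologicalSpace X] : IsUniformAddGroup C(X, ℂ) :=
  let φ : C(X, ℂ) →+ UniformOnFun X ℂ {K | IsCompact K} :=
    { toFun := ContinuousMap.toUniformOnFunIsCompact
      map_zero' := rfl
      map_add' := fun _ _ => rfl }
  IsUniformInducing.isUniformAddGroup φ
    ContinuousMap.isUniformEmbedding_toUniformOnFunIsCompact.isUniformInducing

instance : IsUniformAddGroup (Hol V) :=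
  inferInstanceAs (IsUniformAddGroup (Hol V).toSubmodule.toAddSubgroup)

instance : IsTopologicalAddGroup (Hol V) := IsUniformAddGroup.to_topologicalAddGroup

instance : ContinuousAdd (Hol V) :=
  (inferInstance : IsTopologicalAddGroup (Hol V)).toContinuousAdd

instance : ContinuousSub (Hol V) := IsTopologicalAddGroup.to_continuousSub (G := Hol V)

theorem supNorm_le_iff {K : Compacts V} {f : Hol V} {C : ℝ} (hC : 0 ≤ C) :
    supNorm K f ≤ C ↔ ∀ z ∈ K, ‖f.1 z‖ ≤ C := by
  unfold supNorm
  rw [ContinuousMap.norm_le _ hC]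
  exact ⟨fun h z hz => h ⟨z, hz⟩, fun h z => h z.1 z.2⟩

theorem norm_apply_le_supNorm {K : Compacts V} (f : Hol V) {z : V} (hz : z ∈ K) :
    ‖f.1 z‖ ≤ supNorm K f :=
  (supNorm_le_iff (supNorm_nonneg K f)).1 le_rfl z hz

theorem supNorm_mono {K L : Compacts V} (h : K ≤ L) (f : Hol V) : supNorm K f ≤ supNorm L f :=
  (supNorm_le_iff (supNorm_nonneg L f)).2 fun _ hz => norm_apply_le_supNorm f (h hz)

theorem supNorm_one_le (K : Compacts V) : supNorm K (1 : Hol V) ≤ 1 :=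
  (supNorm_le_iff zero_le_one).2 fun z _ => by
    change ‖(1 : ℂ)‖ ≤ 1
    simp

/-- The seminorms `‖·‖_K` on the space of holomorphic functions. -/
def holSeminorm (V : Set ℂ) : SeminormFamily ℂ (Hol V) (Compacts V) := fun K =>
  Seminorm.of (supNorm K) (supNorm_add_le K) (supNorm_smul K)

theorem continuous_supNorm (K : Compacts V) : Continuous (supNorm K : Hol V → ℝ) :=
  continuous_norm.comp ((ContinuousMap.continuous_restrict _).comp continuous_subtype_val)

theorem withSeminorms_hol (V : Set ℂ) : WithSeminorms (holSeminorm V) := by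
  rw [SeminormFamily.withSeminorms_iff_nhds_eq_iInf]
  apply le_antisymm
  · refine le_iInf fun K => ?_
    rw [← tendsto_iff_comap]
    exact (continuous_supNorm K).tendsto' 0 0 (supNorm_zero K)
  · rw [← tendsto_id', tendsto_subtype_rng,
      ContinuousMap.tendsto_iff_forall_isCompact_tendstoUniformlyOn]
    intro K hK
    rw [Metric.tendstoUniformlyOn_iff]
    intro ε hε
    have h : ∀ᶠ f in (𝓝 (0 : ℝ)).comap (holSeminorm V ⟨K, hK⟩), supNorm ⟨K, hK⟩ f < ε := by
      have := (tendsto_comap (f := holSeminorm V ⟨K, hK⟩) (x := 𝓝 0)).eventually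
        (gt_mem_nhds hε)
      exact this
    have h' := h.filter_mono (iInf_le (fun L => (𝓝 (0 : ℝ)).comap (holSeminorm V L)) ⟨K, hK⟩)
    filter_upwards [h'] with f hf z hz
    rw [dist_comm]
    change dist (f.1 z) 0 < ε
    rw [dist_zero_right]
    exact (norm_apply_le_supNorm (K := ⟨K, hK⟩) f hz).trans_lt hf

/-- The sets `{f | ‖f‖_K < ε}` form a basis of neighbourhoods of `0`. -/
theorem exists_supNorm_lt_subset {N : Set (Hol V)} (hN : N ∈ 𝓝 0) :
    ∃ K : Compacts V, ∃ ε > 0, ∀ f, supNorm K f < ε → f ∈ N := by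
  obtain ⟨s, r, hr, hs⟩ := ((withSeminorms_hol V).mem_nhds_iff 0 N).1 hN
  refine ⟨s.sup id, r, hr, fun f hf => hs ?_⟩
  rw [Seminorm.mem_ball_zero]
  exact Seminorm.finset_sup_apply_lt hr fun K hK =>
    (supNorm_mono (Finset.le_sup (f := id) hK) f).trans_lt hf

instance : T2Space (Hol V) := inferInstanceAs (T2Space {f // f ∈ Hol V})

theorem continuous_linearMap_hol {F ι : Type*} [AddCommGroup F] [Module ℂ F]
    [TopologicalSpace F] {p : SeminormFamily ℂ F ι} (hp : WithSeminorms p) (f : Hol V →ₗ[ℂ] F)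
    (hf : ∀ i, ∃ (L : Compacts V) (C : ℝ), ∀ a, p i (f a) ≤ C * supNorm L a) : Continuous f := by
  have := hp.topologicalAddGroup
  refine continuous_of_continuousAt_zero f.toAddMonoidHom ?_
  refine (hp.tendsto_nhds _ _).2 fun i ε hε => ?_
  obtain ⟨L, C, h⟩ := hf i
  have hc : Continuous fun a : Hol V => C * supNorm L a :=
    continuous_const.mul (continuous_supNorm L)
  filter_upwards [(hc.tendsto' 0 0 (by rw [supNorm_zero, mul_zero])).eventually
    (gt_mem_nhds hε)] with a ha
  rw [map_zero, sub_zero]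
  exact (h a).trans_lt ha

theorem continuous_of_supNorm_le {E : Type*} [AddCommGroup E] [Module ℂ E] [TopologicalSpace E]
    [IsTopologicalAddGroup E] (f : E →ₗ[ℂ] Hol V)
    (h : ∀ L, ∃ p : Seminorm ℂ E, Continuous p ∧ ∀ x, supNorm L (f x) ≤ p x) : Continuous f := by
  refine (withSeminorms_hol V).continuous_of_continuous_comp f fun L => ?_
  obtain ⟨p, hp, hfp⟩ := h L
  exact Seminorm.continuous_of_le hp hfp

/-- A function on `V` is holomorphic iff its extension by zero is. -/
theorem mem_hol_iff {f : C(V, ℂ)} :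
    f ∈ Hol V ↔ DifferentiableOn ℂ (Function.extend Subtype.val f 0) V := by
  have key : ∀ z : V, Function.extend Subtype.val f 0 (z : ℂ) = f z := fun z =>
    Subtype.val_injective.extend_apply f 0 z
  refine ⟨?_, fun h => ⟨_, h, fun z => (key z).symm⟩⟩
  rintro ⟨F, hF, hf⟩
  exact hF.congr fun z hz => (key ⟨z, hz⟩).trans (hf ⟨z, hz⟩)

theorem extend_apply (f : C(V, ℂ)) (z : V) : Function.extend Subtype.val f 0 (z : ℂ) = f z :=
  Subtype.val_injective.extend_apply f 0 z

/-- A locally uniform limit of holomorphic functions is holomorphic. -/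
theorem isClosed_hol (hV : IsOpen V) : IsClosed (Hol V : Set C(V, ℂ)) := by
  rw [isClosed_iff_clusterPt]
  intro f hf
  have : (𝓝 f ⊓ 𝓟 (Hol V : Set C(V, ℂ))).NeBot := hf
  rw [SetLike.mem_coe, mem_hol_iff]
  refine TendstoLocallyUniformlyOn.differentiableOn
    (F := fun g : C(V, ℂ) => Function.extend Subtype.val g 0)
    (φ := 𝓝 f ⊓ 𝓟 (Hol V : Set C(V, ℂ))) ?_ ?_ hV
  · rw [tendstoLocallyUniformlyOn_iff_forall_isCompact hV]
    intro K hKV hK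
    have hK' : IsCompact (Subtype.val ⁻¹' K : Set V) :=
      IsEmbedding.subtypeVal.isCompact_preimage_iff (by simpa using hKV) |>.2 hK
    have h1 : Tendsto (fun g : C(V, ℂ) => g) (𝓝 f ⊓ 𝓟 (Hol V : Set C(V, ℂ))) (𝓝 f) :=
      tendsto_id'.2 inf_le_left
    have h2 := ContinuousMap.tendsto_iff_forall_isCompact_tendstoUniformlyOn.1 h1 _ hK'
    rw [Metric.tendstoUniformlyOn_iff] at h2 ⊢
    intro ε hε
    filter_upwards [h2 ε hε] with g hg z hz
    have := hg ⟨z, hKV hz⟩ hz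
    rwa [← extend_apply f, ← extend_apply g] at this
  · exact (eventually_inf_principal).2 (Eventually.of_forall fun g hg => mem_hol_iff.1 hg)

theorem completeSpace_hol (hV : IsOpen V) : CompleteSpace (Hol V) := by
  have : LocallyCompactSpace V := hV.locallyCompactSpace
  exact (isClosed_hol hV).completeSpace_coe

end Hol

variable {q : ℂ} {U : Opens (QPlane q)}

/-! ### The two traces of an open set -/

theorem isOpen_Ux_standard (U : Opens (QPlane q)) : IsOpen (Ux U) := (isOpen_Ux U).1

theorem isOpen_Uy_standard (U : Opens (QPlane q)) : IsOpen (Uy U) := by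
  obtain ⟨r, hr⟩ := isOpen_Uy U
  rw [hr]
  exact Metric.isOpen_eball

theorem mem_Uy_of_norm_le {w z : ℂ} (hw : w ∈ Uy U) (h : ‖z‖ ≤ ‖w‖) : z ∈ Uy U := by
  obtain ⟨r, hr⟩ := isOpen_Uy U
  rw [hr, Metric.mem_eball, edist_zero_right] at hw ⊢
  exact (enorm_le_iff_norm_le.2 h).trans_lt hw

theorem ofReal_norm_mem_Uy {w : ℂ} (hw : w ∈ Uy U) : ((‖w‖ : ℝ) : ℂ) ∈ Uy U :=
  mem_Uy_of_norm_le hw (by simp)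

/-- The modulus of a point of `U_y`, as a radius. -/
def normRadius {w : ℂ} (hw : w ∈ Uy U) : Radius U := ⟨‖w‖₊, ofReal_norm_mem_Uy hw⟩

theorem Radius.mem_Uy (ρ : Radius U) {z : ℂ} (h : ‖z‖ ≤ ρ.1) : z ∈ Uy U :=
  mem_Uy_of_norm_le ρ.2 (by simpa using h)

/-- There is no largest radius, as `U_y` is an open disk. -/
theorem Radius.exists_gt (ρ : Radius U) : ∃ σ : Radius U, ρ.1 < σ.1 := by
  obtain ⟨r, hr⟩ := isOpen_Uy U
  have h : (((ρ.1 : NNReal) : ℝ) : ℂ) ∈ Metric.eball 0 r := hr ▸ ρ.2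
  rw [Metric.mem_eball, edist_zero_right] at h
  obtain ⟨σ, h1, h2⟩ := ENNReal.lt_iff_exists_nnreal_btwn.1 h
  refine ⟨⟨σ, ?_⟩, ?_⟩
  · rw [hr, Metric.mem_eball, edist_zero_right]
    simpa [enorm_eq_nnnorm] using h2
  · simpa [enorm_eq_nnnorm] using h1

theorem zero_mem_Uy_iff : (0 : ℂ) ∈ Uy U ↔ (0 : ℂ) ∈ Ux U := Iff.rfl

/-- A nonempty disk `U_y` has a positive radius. -/
theorem exists_radius_pos (h0 : (0 : ℂ) ∈ Ux U) : ∃ ρ : Radius U, 0 < ρ.1 := by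
  obtain ⟨σ, hσ⟩ := Radius.exists_gt (normRadius (zero_mem_Uy_iff.2 h0))
  exact ⟨σ, lt_of_le_of_lt (zero_le) hσ⟩

/-! If the origin is not in `U_x`, then `U` is empty and all the algebras are zero. -/

theorem subsingleton_hol_Ux (h0 : (0 : ℂ) ∉ Ux U) : Subsingleton (Hol (Ux U)) :=
  ⟨fun _ _ => Subtype.ext <| ContinuousMap.ext fun z => absurd (spiraling_of_mem U z.2).1 h0⟩

theorem subsingleton_hol_Uy (h0 : (0 : ℂ) ∉ Ux U) : Subsingleton (Hol (Uy U)) :=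
  ⟨fun _ _ => Subtype.ext <| ContinuousMap.ext fun z =>
    absurd (zero_mem_Uy_iff.1 (mem_Uy_of_norm_le z.2 (by simp))) h0⟩

theorem subsingleton_oq (hq : ‖q‖ < 1) (h0 : (0 : ℂ) ∉ Ux U) : Subsingleton (Oq hq U) := by
  have := subsingleton_hol_Ux h0
  exact ⟨fun f g => Subtype.ext <| QSeries.ext fun n => Subsingleton.elim _ _⟩

/-! ### The locally convex space `𝒪_q(U)` -/

section Oq

variable (hq : ‖q‖ < 1)

theorem oqSeminorm_apply (K : Compacts (Ux U)) (ρ : Radius U) (f : Oq hq U) :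
    oqSeminorm hq U K ρ f = ∑' n : ℕ, supNorm K (f.1.coeff n) * (ρ.1 : ℝ) ^ n := rfl

theorem hasSum_oqSeminorm (K : Compacts (Ux U)) (ρ : Radius U) (f : Oq hq U) :
    HasSum (fun n : ℕ => supNorm K (f.1.coeff n) * (ρ.1 : ℝ) ^ n) (oqSeminorm hq U K ρ f) := by
  rw [oqSeminorm_apply]
  exact (f.2 K ρ).hasSum

theorem oqTerm_nonneg (K : Compacts (Ux U)) (ρ : Radius U) (f : Oq hq U) (n : ℕ) :
    0 ≤ supNorm K (f.1.coeff n) * (ρ.1 : ℝ) ^ n :=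
  mul_nonneg (supNorm_nonneg _ _) (by positivity)

theorem coeff_mul_pow_le (K : Compacts (Ux U)) (ρ : Radius U) (f : Oq hq U) (n : ℕ) :
    supNorm K (f.1.coeff n) * (ρ.1 : ℝ) ^ n ≤ oqSeminorm hq U K ρ f :=
  (f.2 K ρ).le_tsum n fun m _ => oqTerm_nonneg hq K ρ f m

theorem oqSeminorm_mono {K L : Compacts (Ux U)} {ρ σ : Radius U} (hK : K ≤ L) (hρ : ρ.1 ≤ σ.1)
    (f : Oq hq U) : oqSeminorm hq U K ρ f ≤ oqSeminorm hq U L σ f := by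
  refine (f.2 K ρ).tsum_le_tsum (fun n => ?_) (f.2 L σ)
  have hρ' : (ρ.1 : ℝ) ≤ σ.1 := hρ
  exact mul_le_mul (supNorm_mono hK _) (pow_le_pow_left₀ ρ.1.2 hρ' n) (by positivity)
    (supNorm_nonneg _ _)

/-- The family of all seminorms `p_{K,ρ}`. -/
def oqSeminormFamily (U : Opens (QPlane q)) :
    SeminormFamily ℂ (Oq hq U) (Compacts (Ux U) × Radius U) :=
  fun i => oqSeminorm hq U i.1 i.2

instance : IsUniformAddGroup (Oq hq U) :=
  isUniformAddGroup_iInf fun i : Compacts (Ux U) × Radius U =>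
    @SeminormedAddCommGroup.to_isUniformAddGroup _
      (oqSeminorm hq U i.1 i.2).toSeminormedAddCommGroup

theorem withSeminorms_oq (U : Opens (QPlane q)) : WithSeminorms (oqSeminormFamily hq U) :=
  ((oqSeminormFamily hq U).withSeminorms_iff_uniformSpace_eq_iInf).2 rfl

theorem continuous_oqSeminorm (K : Compacts (Ux U)) (ρ : Radius U) :
    Continuous (oqSeminorm hq U K ρ) :=
  (withSeminorms_oq hq U).continuous_seminorm (K, ρ)

instance : ContinuousSMul ℂ (Oq hq U) := (withSeminorms_oq hq U).continuousSMul

/-- The coefficient `f ↦ fₙ` as a linear map. -/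
def coeffₗ (U : Opens (QPlane q)) (n : ℕ) : Oq hq U →ₗ[ℂ] Hol (Ux U) where
  toFun f := f.1.coeff n
  map_add' _ _ := rfl
  map_smul' _ _ := rfl

theorem continuous_coeffₗ (n : ℕ) : Continuous (coeffₗ hq U n) := by
  by_cases h0 : (0 : ℂ) ∈ Ux U
  · obtain ⟨ρ, hρ⟩ := exists_radius_pos h0
    refine continuous_of_supNorm_le _ fun K => ⟨((ρ.1 ^ n)⁻¹ : NNReal) • oqSeminorm hq U K ρ,
      (continuous_oqSeminorm hq K ρ).const_smul _, fun f => ?_⟩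
    change supNorm K (f.1.coeff n) ≤ ((ρ.1 ^ n)⁻¹ : NNReal) • oqSeminorm hq U K ρ f
    rw [NNReal.smul_def, smul_eq_mul, NNReal.coe_inv, NNReal.coe_pow,
      le_inv_mul_iff₀ (by positivity), mul_comm]
    exact coeff_mul_pow_le hq K ρ f n
  · have := subsingleton_hol_Ux h0
    exact continuous_of_const fun _ _ => Subsingleton.elim _ _

instance : T2Space (Oq hq U) := by
  refine T2Space.of_injective_continuous (f := fun (f : Oq hq U) (n : ℕ) => coeffₗ hq U n f)
    (fun f g h => Subtype.ext (QSeries.ext fun n => congrFun h n))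
    (continuous_pi fun n => continuous_coeffₗ hq n)

/-- Countably many seminorms `p_{K,ρ}` suffice: the sets `K` of a compact exhaustion of `U_x`, and
the rational radii `ρ`. -/
theorem isCountablyGenerated_uniformity_oq :
    (uniformity (Oq hq U)).IsCountablyGenerated := by
  have : LocallyCompactSpace (Ux U) := (isOpen_Ux_standard U).locallyCompactSpace
  have : SigmaCompactSpace (Ux U) := inferInstance
  let E : CompactExhaustion (Ux U) := CompactExhaustion.choice _
  let K : ℕ → Compacts (Ux U) := fun n => ⟨E n, E.isCompact n⟩
  let Q : Type := {x : NNRat // (((x : NNReal) : ℝ) : ℂ) ∈ Uy U}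
  let p : SeminormFamily ℂ (Oq hq U) (ℕ × Q) := fun i => oqSeminorm hq U (K i.1) ⟨i.2.1, i.2.2⟩
  have hp : WithSeminorms p := by
    refine (withSeminorms_oq hq U).congr (fun i => ?_) (fun i => ?_)
    · refine ⟨{(K i.1, ⟨i.2.1, i.2.2⟩)}, 1, ?_⟩
      rw [Finset.sup_singleton, one_smul]
      exact le_rfl
    · obtain ⟨L, ρ⟩ := i
      obtain ⟨σ, hσ⟩ := ρ.exists_gt
      obtain ⟨x, hx1, hx2⟩ := exists_rat_btwn (show (ρ.1 : ℝ) < σ.1 from hσ)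
      have hx0 : (0 : ℚ) ≤ x := by
        exact_mod_cast (ρ.1.2.trans hx1.le)
      lift x to NNRat using hx0
      have hx1' : ρ.1 ≤ (x : NNReal) := by
        rw [← NNReal.coe_le_coe]
        exact_mod_cast hx1.le
      obtain ⟨n, hn⟩ := E.exists_superset_of_isCompact L.isCompact
      have hx : (((x : NNReal) : ℝ) : ℂ) ∈ Uy U := σ.mem_Uy <| by
        rw [Complex.norm_real, Real.norm_of_nonneg (NNReal.coe_nonneg _)]
        exact_mod_cast hx2.le
      refine ⟨{(n, ⟨x, hx⟩)}, 1, fun f => ?_⟩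
      · rw [Finset.sup_singleton, one_smul]
        exact oqSeminorm_mono hq hn hx1' f
  have hcount : (𝓝 (0 : Oq hq U)).IsCountablyGenerated := by
    have := hp.firstCountableTopology
    infer_instance
  exact IsUniformAddGroup.uniformity_countably_generated

theorem supNorm_sub_comm {V : Set ℂ} (K : Compacts V) (f g : Hol V) :
    supNorm K (f - g) = supNorm K (g - f) :=
  map_sub_rev (holSeminorm V K) f g

instance : CompleteSpace (Oq hq U) := by
  have := isCountablyGenerated_uniformity_oq hq (U := U)
  have := completeSpace_hol (isOpen_Ux_standard U)
  refine UniformSpace.complete_of_cauchySeq_tendsto fun f hf => ?_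
  have h1 : ∀ n, ∃ g, Tendsto (fun k => coeffₗ hq U n (f k)) atTop (𝓝 g) := fun n =>
    cauchySeq_tendsto_of_complete
      (hf.map (uniformContinuous_addMonoidHom_of_continuous (f := (coeffₗ hq U n).toAddMonoidHom)
        (continuous_coeffₗ hq n)))
  choose g hg using h1
  -- the coefficientwise limit `g` is approached in each seminorm: bound finite partial sums and
  -- pass to the limit in the second index of the Cauchy condition
  have h2 : ∀ (K : Compacts (Ux U)) (ρ : Radius U) (ε : ℝ), 0 < ε → ∃ N, ∀ k ≥ N,
      ∀ s : Finset ℕ, ∑ n ∈ s, supNorm K ((f k).1.coeff n - g n) * (ρ.1 : ℝ) ^ n ≤ ε := by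
    intro K ρ ε hε
    have hV : {x : Oq hq U × Oq hq U | oqSeminorm hq U K ρ (x.2 - x.1) < ε} ∈
        uniformity (Oq hq U) := by
      rw [uniformity_eq_comap_nhds_zero]
      refine ⟨{x | oqSeminorm hq U K ρ x < ε}, ?_, fun _ h => h⟩
      exact (continuous_oqSeminorm hq K ρ).tendsto' 0 0 (map_zero _) |>.eventually (gt_mem_nhds hε)
    obtain ⟨N, hN⟩ := cauchySeq_iff.1 hf _ hV
    refine ⟨N, fun k hk s => ?_⟩
    have hlim : Tendsto (fun l => ∑ n ∈ s, supNorm K ((f k).1.coeff n - (f l).1.coeff n) *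
        (ρ.1 : ℝ) ^ n) atTop (𝓝 (∑ n ∈ s, supNorm K ((f k).1.coeff n - g n) * (ρ.1 : ℝ) ^ n)) := by
      refine tendsto_finsetSum _ fun n _ => Tendsto.mul_const _ ?_
      exact ((continuous_supNorm K).tendsto _).comp (tendsto_const_nhds.sub (hg n))
    refine le_of_tendsto hlim ((eventually_ge_atTop N).mono fun l hl => ?_)
    refine le_trans ?_ (hN l hl k hk).le
    exact ((f k - f l).2 K ρ).sum_le_tsum s fun n _ => oqTerm_nonneg hq K ρ (f k - f l) n
  have hnn : ∀ (K : Compacts (Ux U)) (ρ : Radius U) (k n : ℕ),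
      0 ≤ supNorm K ((f k).1.coeff n - g n) * (ρ.1 : ℝ) ^ n :=
    fun K ρ k n => mul_nonneg (supNorm_nonneg _ _) (by positivity)
  let G : QSeries U := g
  have hG : IsAbsConv G := by
    intro K ρ
    obtain ⟨N, hN⟩ := h2 K ρ 1 one_pos
    have hs := (summable_of_sum_le (hnn K ρ N) (hN N le_rfl)).add ((f N).2 K ρ)
    refine Summable.of_nonneg_of_le
      (fun n => mul_nonneg (supNorm_nonneg _ _) (by positivity)) (fun n => ?_) hs
    rw [← add_mul]
    refine mul_le_mul_of_nonneg_right ?_ (by positivity)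
    rw [supNorm_sub_comm]
    exact le_trans (le_of_eq (congrArg _ (sub_add_cancel (g n) ((f N).1.coeff n)).symm))
      (supNorm_add_le K _ _)
  refine ⟨⟨G, hG⟩, ((withSeminorms_oq hq U).tendsto_nhds _ _).2 fun i ε hε => ?_⟩
  obtain ⟨N, hN⟩ := h2 i.1 i.2 (ε / 2) (half_pos hε)
  filter_upwards [eventually_ge_atTop N] with k hk
  refine lt_of_le_of_lt ?_ (half_lt_self hε)
  exact Real.tsum_le_of_sum_le (hnn i.1 i.2 k) (hN k hk)

/-- The seminorms are submultiplicative up to an enlargement of the compact set, which has to absorb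
only the dilations `x ↦ qⁱ x` for the powers `yⁱ` that occur in the left factor. -/
theorem oqSeminorm_mul_le {K L : Compacts (Ux U)} (ρ : Radius U) (f g : Oq hq U)
    (h : ∀ i, f.1.coeff i ≠ 0 → ∀ a, supNorm K (scale U i a) ≤ supNorm L a) :
    oqSeminorm hq U K ρ (f * g) ≤ oqSeminorm hq U K ρ f * oqSeminorm hq U L ρ g := by
  have ha : Summable fun n => ‖supNorm K (f.1.coeff n) * (ρ.1 : ℝ) ^ n‖ := (f.2 K ρ).norm
  have hb : Summable fun n => ‖supNorm L (g.1.coeff n) * (ρ.1 : ℝ) ^ n‖ := (g.2 L ρ).norm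
  rw [oqSeminorm_apply, oqSeminorm_apply, oqSeminorm_apply,
    tsum_mul_tsum_eq_tsum_sum_antidiagonal_of_summable_norm ha hb]
  refine ((f * g).2 K ρ).tsum_le_tsum (fun n => ?_)
    (summable_norm_sum_mul_antidiagonal_of_summable_norm ha hb).of_norm
  have hn : (f * g).1.coeff n = _ := QSeries.coeff_mul f.1 g.1 n
  rw [hn]
  refine (mul_le_mul_of_nonneg_right (supNorm_sum_le K _ _) (by positivity)).trans ?_
  rw [Finset.sum_mul]
  refine Finset.sum_le_sum fun p hp => ?_
  rw [← Finset.HasAntidiagonal.mem_antidiagonal.1 hp, pow_add]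
  have key : supNorm K (f.1.coeff p.1 * scale U p.1 (g.1.coeff p.2)) ≤
      supNorm K (f.1.coeff p.1) * supNorm L (g.1.coeff p.2) := by
    by_cases h0 : f.1.coeff p.1 = 0
    · rw [h0, zero_mul, supNorm_zero, zero_mul]
    · exact (supNorm_mul_le K _ _).trans
        (mul_le_mul_of_nonneg_left (h _ h0 _) (supNorm_nonneg _ _))
  calc _ ≤ supNorm K (f.1.coeff p.1) * supNorm L (g.1.coeff p.2) *
        ((ρ.1 : ℝ) ^ p.1 * (ρ.1 : ℝ) ^ p.2) := mul_le_mul_of_nonneg_right key (by positivity)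
    _ = _ := by ring

instance : ContinuousMul (Oq hq U) where
  continuous_mul := by
    rw [continuous_iff_continuousAt]
    rintro ⟨f₀, g₀⟩
    refine ((withSeminorms_oq hq U).tendsto_nhds _ _).2 fun ⟨K, ρ⟩ ε hε => ?_
    obtain ⟨L, hL⟩ := exists_hull hq U K
    have hc : Continuous fun x : Oq hq U × Oq hq U =>
        oqSeminorm hq U K ρ (x.1 - f₀) * oqSeminorm hq U L ρ x.2 +
          oqSeminorm hq U K ρ f₀ * oqSeminorm hq U L ρ (x.2 - g₀) :=
      (((continuous_oqSeminorm hq K ρ).comp (continuous_fst.sub continuous_const)).mul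
        ((continuous_oqSeminorm hq L ρ).comp continuous_snd)).add
        (continuous_const.mul
          ((continuous_oqSeminorm hq L ρ).comp (continuous_snd.sub continuous_const)))
    have ht := hc.tendsto' (f₀, g₀) 0 (by simp)
    filter_upwards [ht.eventually (gt_mem_nhds hε)] with x hx
    refine lt_of_le_of_lt ?_ hx
    change oqSeminorm hq U K ρ (x.1 * x.2 - f₀ * g₀) ≤ _
    have hsplit : x.1 * x.2 - f₀ * g₀ = (x.1 - f₀) * x.2 + f₀ * (x.2 - g₀) := by
      rw [sub_mul, mul_sub]; abel
    rw [hsplit]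
    exact (map_add_le_add _ _ _).trans (add_le_add
      (oqSeminorm_mul_le hq ρ _ _ fun i _ a => hL i a)
      (oqSeminorm_mul_le hq ρ _ _ fun i _ a => hL i a))

theorem isFrechetAlgebra_oq (U : Opens (QPlane q)) : IsFrechetAlgebra (Oq hq U) where
  isUniformAddGroup := inferInstance
  continuousSMul := inferInstance
  polynormable := (withSeminorms_oq hq U).toPolynormableSpace
  complete := inferInstance
  metrizable := by
    have := isCountablyGenerated_uniformity_oq hq (U := U)
    have := UniformSpace.pseudoMetrizableSpace (X := Oq hq U)
    exact PseudoMetrizableSpace.toMetrizableSpace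
  continuousMul := inferInstance

instance : IsTopologicalRing (Oq hq U) where

/-! ### Monomials -/

/-- The monomial `a(x) yⁿ`. -/
def monomial (U : Opens (QPlane q)) (n : ℕ) : Hol (Ux U) →ₗ[ℂ] Oq hq U where
  toFun a := ⟨(Pi.single n a : ℕ → Hol (Ux U)), fun K ρ => by
    refine summable_of_ne_finset_zero (s := {n}) fun m hm => ?_
    have hmn : m ≠ n := by simpa using hm
    have h0 : QSeries.coeff (Pi.single n a : ℕ → Hol (Ux U)) m = 0 :=
      Pi.single_eq_of_ne (M := fun _ => Hol (Ux U)) hmn a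
    rw [h0, supNorm_zero, zero_mul]⟩
  map_add' a b := Subtype.ext (Pi.single_add (f := fun _ => Hol (Ux U)) n a b)
  map_smul' c a := Subtype.ext (Pi.single_smul (f := fun _ => Hol (Ux U)) n c a)

theorem coeff_monomial (n : ℕ) (a : Hol (Ux U)) (m : ℕ) :
    (monomial hq U n a).1.coeff m = if m = n then a else 0 := by
  change (Pi.single n a : ℕ → Hol (Ux U)) m = _
  rw [Pi.single_apply]

theorem oqSeminorm_monomial (K : Compacts (Ux U)) (ρ : Radius U) (n : ℕ) (a : Hol (Ux U)) :
    oqSeminorm hq U K ρ (monomial hq U n a) = supNorm K a * (ρ.1 : ℝ) ^ n := by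
  rw [oqSeminorm_apply, tsum_eq_single n]
  · rw [coeff_monomial, if_pos rfl]
  · intro m hm
    rw [coeff_monomial, if_neg hm, supNorm_zero, zero_mul]

theorem continuous_monomial (n : ℕ) : Continuous (monomial hq U n) := by
  refine continuous_linearMap_hol (withSeminorms_oq hq U) (monomial hq U n) fun ⟨K, ρ⟩ =>
    ⟨K, (ρ.1 : ℝ) ^ n, fun a => ?_⟩
  rw [mul_comm]
  exact (oqSeminorm_monomial hq K ρ n a).le

theorem monomial_mul_monomial (m n : ℕ) (a b : Hol (Ux U)) :
    monomial hq U m a * monomial hq U n b = monomial hq U (m + n) (a * scale U m b) := by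
  refine Subtype.ext (QSeries.ext fun k => ?_)
  have hk : (monomial hq U m a * monomial hq U n b).1.coeff k = _ :=
    QSeries.coeff_mul (monomial hq U m a).1 (monomial hq U n b).1 k
  rw [hk]
  simp only [coeff_monomial]
  split_ifs with h
  · subst h
    rw [Finset.sum_eq_single (m, n)]
    · simp
    · rintro ⟨i, j⟩ hp hne
      rw [Finset.HasAntidiagonal.mem_antidiagonal] at hp
      by_cases hi : i = m
      · have hj : j ≠ n := fun hj => hne (by rw [hi, hj])
        simp [hj]
      · simp [hi]
    · simp
  · refine Finset.sum_eq_zero ?_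
    rintro ⟨i, j⟩ hp
    rw [Finset.HasAntidiagonal.mem_antidiagonal] at hp
    by_cases hi : i = m
    · have hj : j ≠ n := fun hj => h (by rw [← hp, hi, hj])
      simp [hj]
    · simp [hi]

theorem monomial_zero_one : monomial hq U 0 1 = 1 :=
  Subtype.ext (QSeries.ext fun n => coeff_monomial hq 0 1 n)

/-- The series `∑ fₙ(x) yⁿ` converges to `f` in `𝒪_q(U)`. -/
theorem hasSum_monomial (f : Oq hq U) : HasSum (fun n => monomial hq U n (f.1.coeff n)) f := by
  have hs : Summable fun n => monomial hq U n (f.1.coeff n) := by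
    refine summable_of_summable_seminorm (withSeminorms_oq hq U) fun ⟨K, ρ⟩ => ?_
    exact (f.2 K ρ).congr fun n => (oqSeminorm_monomial hq K ρ n _).symm
  obtain ⟨g, hg⟩ := hs
  convert! hg
  refine Subtype.ext (QSeries.ext fun k => ?_)
  have h1 := hg.map (coeffₗ hq U k) (continuous_coeffₗ hq k)
  refine HasSum.unique ?_ h1
  convert! hasSum_single (f := fun n => coeffₗ hq U k (monomial hq U n (f.1.coeff n))) k ?_
  · exact ((coeff_monomial hq k _ k).trans (if_pos rfl)).symm
  · intro n hn
    exact (coeff_monomial hq n _ k).trans (if_neg hn.symm)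

end Oq

/-! ### Power series on the disk `U_y` -/

/-- Identity theorem: a power series that sums to zero near the origin has zero coefficients. -/
theorem powerSeries_coeff_eq_zero {d : ℕ → ℂ} {V : Set ℂ} (hV : V ∈ 𝓝 (0 : ℂ))
    (h : ∀ w ∈ V, HasSum (fun n => d n * w ^ n) 0) : d = 0 := by
  have h1 : HasFPowerSeriesAt (0 : ℂ → ℂ) (FormalMultilinearSeries.ofScalars ℂ d) 0 := by
    rw [hasFPowerSeriesAt_iff]
    filter_upwards [hV] with w hw
    simpa [FormalMultilinearSeries.coeff_ofScalars, mul_comm] using h w hw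
  have h2 := h1.eq_zero
  funext n
  rw [← FormalMultilinearSeries.coeff_ofScalars (𝕜 := ℂ) (p := d), h2]
  rfl

/-- The `n`-th Taylor coefficient at the origin of a holomorphic function on `V`, computed from its
extension by zero; meaningful only if `V` is a neighbourhood of the origin. -/
def taylorCoeff {V : Set ℂ} (b : Hol V) (n : ℕ) : ℂ :=
  (n.factorial : ℂ)⁻¹ * iteratedDeriv n (Function.extend Subtype.val b.1 0) 0

theorem hasSum_taylorCoeff (b : Hol (Uy U)) (w : Uy U) :
    HasSum (fun n => taylorCoeff b n * (w : ℂ) ^ n) (b.1 w) := by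
  obtain ⟨r, hr⟩ := isOpen_Uy U
  have hd : DifferentiableOn ℂ (Function.extend Subtype.val b.1 0) (Metric.eball 0 r) := by
    rw [← hr]
    exact mem_hol_iff.1 b.2
  have hw : (w : ℂ) ∈ Metric.eball 0 r := hr ▸ w.2
  have h := Complex.hasSum_taylorSeries_on_eball hd hw
  rw [extend_apply] at h
  refine h.congr_fun fun n => ?_
  simp only [taylorCoeff, sub_zero, smul_eq_mul]
  ring

theorem taylorCoeff_unique (h0 : (0 : ℂ) ∈ Ux U) {b : Hol (Uy U)} {c : ℕ → ℂ}
    (h : ∀ w : Uy U, HasSum (fun n => c n * (w : ℂ) ^ n) (b.1 w)) : taylorCoeff b = c := by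
  rw [← sub_eq_zero]
  refine powerSeries_coeff_eq_zero
    ((isOpen_Uy_standard U).mem_nhds (zero_mem_Uy_iff.2 h0)) fun w hw => ?_
  have := (hasSum_taylorCoeff b ⟨w, hw⟩).sub (h ⟨w, hw⟩)
  rw [sub_self] at this
  exact this.congr_fun fun n => by simp [sub_mul]

/-- The closed disk of radius `ρ`, as a compact subset of `U_y`. -/
def closedDisk (ρ : Radius U) : Compacts (Uy U) where
  carrier := Subtype.val ⁻¹' Metric.closedBall (0 : ℂ) ρ.1
  isCompact' := IsEmbedding.subtypeVal.isCompact_preimage_iff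
    (by
      rw [Subtype.range_coe]
      exact fun z hz => ρ.mem_Uy (mem_closedBall_zero_iff.1 hz)) |>.2 (isCompact_closedBall _ _)

theorem mem_closedDisk {ρ : Radius U} {w : Uy U} : w ∈ closedDisk ρ ↔ ‖(w : ℂ)‖ ≤ ρ.1 :=
  mem_closedBall_zero_iff

/-- The closed disks are cofinal among the compact subsets of `U_y`. -/
theorem exists_le_closedDisk (h0 : (0 : ℂ) ∈ Ux U) (L : Compacts (Uy U)) :
    ∃ ρ : Radius U, L ≤ closedDisk ρ := by
  rcases (L : Set (Uy U)).eq_empty_or_nonempty with h | h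
  · refine ⟨normRadius (zero_mem_Uy_iff.2 h0), fun w hw => ?_⟩
    change w ∈ (L : Set (Uy U)) at hw
    rw [h] at hw
    exact absurd hw (Set.notMem_empty w)
  · obtain ⟨w, -, hw⟩ := L.isCompact.exists_isMaxOn h
      (continuous_subtype_val.norm.continuousOn)
    exact ⟨normRadius w.2, fun z hz => mem_closedDisk.2 (hw hz)⟩

/-- Cauchy's estimate. -/
theorem norm_taylorCoeff_mul_pow_le (ρ : Radius U) (hρ : 0 < ρ.1) (b : Hol (Uy U)) (n : ℕ) :
    ‖taylorCoeff b n‖ * (ρ.1 : ℝ) ^ n ≤ supNorm (closedDisk ρ) b := by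
  have hρ' : (0 : ℝ) < ρ.1 := hρ
  have hd := mem_hol_iff.1 b.2
  have hsub : Metric.closedBall (0 : ℂ) ρ.1 ⊆ Uy U := fun z hz =>
    ρ.mem_Uy (mem_closedBall_zero_iff.1 hz)
  have h := Complex.norm_iteratedDeriv_le_of_forall_mem_sphere_norm_le (c := 0) (R := ρ.1)
    (C := supNorm (closedDisk ρ) b) (f := Function.extend Subtype.val b.1 0) n hρ'
    ((hd.mono hsub).diffContOnCl_ball le_rfl) (fun z hz => by
      have hz' := Metric.sphere_subset_closedBall hz
      have := extend_apply b.1 ⟨z, hsub hz'⟩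
      rw [show z = ((⟨z, hsub hz'⟩ : Uy U) : ℂ) from rfl, this]
      exact norm_apply_le_supNorm b (mem_closedDisk.2 (mem_closedBall_zero_iff.1 hz')))
  rw [taylorCoeff, norm_mul, norm_inv, Complex.norm_natCast]
  calc _ ≤ (n.factorial : ℝ)⁻¹ * (n.factorial * supNorm (closedDisk ρ) b / (ρ.1 : ℝ) ^ n) *
        (ρ.1 : ℝ) ^ n := by gcongr
    _ = supNorm (closedDisk ρ) b := by
      have : (n.factorial : ℝ) ≠ 0 := by exact_mod_cast n.factorial_ne_zero
      field_simp

/-- Cauchy's estimate on a slightly larger disk bounds the absolute Taylor series. This makes `ι_y`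
well defined and continuous. -/
theorem exists_tsum_taylorCoeff_le (ρ : Radius U) : ∃ (L : Compacts (Uy U)) (C : ℝ),
    ∀ b : Hol (Uy U), Summable (fun n => ‖taylorCoeff b n‖ * (ρ.1 : ℝ) ^ n) ∧
      ∑' n, ‖taylorCoeff b n‖ * (ρ.1 : ℝ) ^ n ≤ C * supNorm L b := by
  obtain ⟨σ, hσ⟩ := ρ.exists_gt
  have hσ0 : 0 < σ.1 := lt_of_le_of_lt (zero_le) hσ
  have hσ0' : (0 : ℝ) < σ.1 := hσ0
  have hr : ((ρ.1 : ℝ) / σ.1) < 1 := (div_lt_one hσ0').2 hσ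
  have hg := summable_geometric_of_lt_one (div_nonneg ρ.1.2 σ.1.2) hr
  refine ⟨closedDisk σ, ∑' n, ((ρ.1 : ℝ) / σ.1) ^ n, fun b => ?_⟩
  have hle : ∀ n, ‖taylorCoeff b n‖ * (ρ.1 : ℝ) ^ n ≤
      ((ρ.1 : ℝ) / σ.1) ^ n * supNorm (closedDisk σ) b := fun n => by
    calc _ = ((ρ.1 : ℝ) / σ.1) ^ n * (‖taylorCoeff b n‖ * (σ.1 : ℝ) ^ n) := by
          rw [div_pow]; field_simp
      _ ≤ _ := by
        gcongr
        exact norm_taylorCoeff_mul_pow_le σ hσ0 b n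
  have hs := Summable.of_nonneg_of_le (fun n => by positivity) hle (hg.mul_right _)
  refine ⟨hs, ?_⟩
  rw [← tsum_mul_right]
  exact hs.tsum_le_tsum hle (hg.mul_right _)

/-- The holomorphic function on `U_y` with given Taylor coefficients. -/
def holOfSeries (c : ℕ → ℂ) (hc : ∀ ρ : Radius U, Summable fun n => ‖c n‖ * (ρ.1 : ℝ) ^ n) :
    Hol (Uy U) :=
  have hd : DifferentiableOn ℂ (fun w => ∑' n, c n * w ^ n) (Uy U) := by
    intro w hw
    obtain ⟨σ, hσ⟩ := (normRadius hw).exists_gt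
    have hσ' : ‖w‖ < σ.1 := hσ
    have h := Complex.differentiableOn_tsum_of_summable_norm (F := fun n (w : ℂ) => c n * w ^ n)
      (U := Metric.ball 0 σ.1) (hc σ) (fun n => by fun_prop) Metric.isOpen_ball (fun n z hz => by
        rw [norm_mul, norm_pow]
        have := (mem_ball_zero_iff.1 hz).le
        gcongr)
    exact (h.differentiableAt (Metric.isOpen_ball.mem_nhds
      (mem_ball_zero_iff.2 hσ'))).differentiableWithinAt
  ⟨⟨(Uy U).domRestrict fun w => ∑' n, c n * w ^ n, hd.continuousOn.domRestrict⟩,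
    _, hd, fun _ => rfl⟩

theorem summable_mul_pow {c : ℕ → ℂ}
    (hc : ∀ ρ : Radius U, Summable fun n => ‖c n‖ * (ρ.1 : ℝ) ^ n)
    (w : Uy U) : Summable fun n => ‖c n * (w : ℂ) ^ n‖ :=
  (hc (normRadius w.2)).congr fun n => by
    rw [norm_mul, norm_pow]
    rfl

theorem hasSum_holOfSeries (c : ℕ → ℂ)
    (hc : ∀ ρ : Radius U, Summable fun n => ‖c n‖ * (ρ.1 : ℝ) ^ n) (w : Uy U) :
    HasSum (fun n => c n * (w : ℂ) ^ n) ((holOfSeries c hc).1 w) :=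
  (summable_mul_pow hc w).of_norm.hasSum

/-- Cauchy product of power series. -/
theorem hasSum_cauchyProduct {c d : ℕ → ℂ} {w s t : ℂ}
    (hc : Summable fun n => ‖c n * w ^ n‖) (hd : Summable fun n => ‖d n * w ^ n‖)
    (hs : HasSum (fun n => c n * w ^ n) s) (ht : HasSum (fun n => d n * w ^ n) t) :
    HasSum (fun n => (∑ p ∈ Finset.HasAntidiagonal.antidiagonal n, c p.1 * d p.2) * w ^ n)
      (s * t) := by
  rw [← hs.tsum_eq, ← ht.tsum_eq, tsum_mul_tsum_eq_tsum_sum_antidiagonal_of_summable_norm hc hd]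
  refine ((summable_norm_sum_mul_antidiagonal_of_summable_norm hc hd).of_norm.hasSum).congr_fun
    fun n => ?_
  rw [Finset.sum_mul]
  refine Finset.sum_congr rfl fun p hp => ?_
  rw [← Finset.HasAntidiagonal.mem_antidiagonal.1 hp, pow_add]
  ring

theorem summable_taylorCoeff (b : Hol (Uy U)) (ρ : Radius U) :
    Summable fun n => ‖taylorCoeff b n‖ * (ρ.1 : ℝ) ^ n := by
  obtain ⟨L, C, h⟩ := exists_tsum_taylorCoeff_le ρ
  exact (h b).1

theorem taylorCoeff_mul (h0 : (0 : ℂ) ∈ Ux U) (b d : Hol (Uy U)) (n : ℕ) :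
    taylorCoeff (b * d) n =
    ∑ p ∈ Finset.HasAntidiagonal.antidiagonal n, taylorCoeff b p.1 * taylorCoeff d p.2 := by
  rw [taylorCoeff_unique h0 (b := b * d)
    (c := fun n => ∑ p ∈ Finset.HasAntidiagonal.antidiagonal n,
      taylorCoeff b p.1 * taylorCoeff d p.2)]
  intro w
  exact hasSum_cauchyProduct (summable_mul_pow (summable_taylorCoeff b) w)
    (summable_mul_pow (summable_taylorCoeff d) w) (hasSum_taylorCoeff b w) (hasSum_taylorCoeff d w)

theorem taylorCoeff_add (h0 : (0 : ℂ) ∈ Ux U) (b d : Hol (Uy U)) (n : ℕ) :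
    taylorCoeff (b + d) n = taylorCoeff b n + taylorCoeff d n := by
  rw [taylorCoeff_unique h0 (b := b + d) (c := fun n => taylorCoeff b n + taylorCoeff d n)]
  intro w
  exact ((hasSum_taylorCoeff b w).add (hasSum_taylorCoeff d w)).congr_fun fun n => add_mul _ _ _

theorem taylorCoeff_smul (h0 : (0 : ℂ) ∈ Ux U) (k : ℂ) (b : Hol (Uy U)) (n : ℕ) :
    taylorCoeff (k • b) n = k * taylorCoeff b n := by
  rw [taylorCoeff_unique h0 (b := k • b) (c := fun n => k * taylorCoeff b n)]
  intro w
  exact ((hasSum_taylorCoeff b w).mul_left k).congr_fun fun n => mul_assoc _ _ _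

theorem taylorCoeff_one (h0 : (0 : ℂ) ∈ Ux U) (n : ℕ) :
    taylorCoeff (1 : Hol (Uy U)) n = if n = 0 then 1 else 0 := by
  rw [taylorCoeff_unique h0 (b := 1) (c := fun n => if n = 0 then 1 else 0)]
  intro w
  convert! hasSum_single (f := fun n => (if n = 0 then (1 : ℂ) else 0) * (w : ℂ) ^ n) 0 ?_
  · simp
  · intro n hn
    simp [hn]

/-! ### The embeddings of `𝒪(U_x)` and `𝒪(U_y)` and the restrictions to the axes -/

section Oq

variable (hq : ‖q‖ < 1)

theorem supNorm_algebraMap_le {V : Set ℂ} (K : Compacts V) (c : ℂ) :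
    supNorm K (algebraMap ℂ (Hol V) c) ≤ ‖c‖ :=
  (supNorm_le_iff (norm_nonneg c)).2 fun _ _ => le_rfl

/-- The series `∑ cₙ yⁿ` with constant coefficients. -/
def constSeries (c : ℕ → ℂ) (hc : ∀ ρ : Radius U, Summable fun n => ‖c n‖ * (ρ.1 : ℝ) ^ n) :
    Oq hq U :=
  ⟨(fun n => algebraMap ℂ (Hol (Ux U)) (c n) : ℕ → Hol (Ux U)), fun K ρ =>
    Summable.of_nonneg_of_le (fun n => mul_nonneg (supNorm_nonneg _ _) (by positivity))
      (fun n => mul_le_mul_of_nonneg_right (supNorm_algebraMap_le K (c n)) (by positivity)) (hc ρ)⟩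

theorem oqSeminorm_constSeries_le (c : ℕ → ℂ)
    (hc : ∀ ρ : Radius U, Summable fun n => ‖c n‖ * (ρ.1 : ℝ) ^ n) (K : Compacts (Ux U))
    (ρ : Radius U) :
    oqSeminorm hq U K ρ (constSeries hq c hc) ≤ ∑' n, ‖c n‖ * (ρ.1 : ℝ) ^ n :=
  ((constSeries hq c hc).2 K ρ).tsum_le_tsum
    (fun n => mul_le_mul_of_nonneg_right (supNorm_algebraMap_le K (c n)) (by positivity)) (hc ρ)

/-- The embedding `a ↦ a(x) y⁰`. -/
def iotaX (U : Opens (QPlane q)) : Hol (Ux U) →ₐ[ℂ] Oq hq U :=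
  AlgHom.ofLinearMap (monomial hq U 0) (monomial_zero_one hq) fun a b => by
    rw [monomial_mul_monomial, scale_zero]

theorem iotaX_apply (a : Hol (Ux U)) : iotaX hq U a = monomial hq U 0 a := rfl

theorem continuous_iotaX : Continuous (iotaX hq U) := continuous_monomial hq 0

/-- The embedding `b ↦ ∑ bₙ yⁿ`, where `bₙ` are the Taylor coefficients of `b`. -/
def iotaY (U : Opens (QPlane q)) : Hol (Uy U) →ₐ[ℂ] Oq hq U :=
  AlgHom.ofLinearMap
    { toFun := fun b => constSeries hq (taylorCoeff b) (summable_taylorCoeff b)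
      map_add' := fun b d => by
        by_cases h0 : (0 : ℂ) ∈ Ux U
        · refine Subtype.ext (QSeries.ext fun n => ?_)
          exact (congrArg (algebraMap ℂ (Hol (Ux U))) (taylorCoeff_add h0 b d n)).trans
            ((Algebra.linearMap ℂ (Hol (Ux U))).map_add _ _)
        · have := subsingleton_oq hq h0
          exact Subsingleton.elim _ _
      map_smul' := fun k b => by
        by_cases h0 : (0 : ℂ) ∈ Ux U
        · refine Subtype.ext (QSeries.ext fun n => ?_)
          exact (congrArg (algebraMap ℂ (Hol (Ux U))) (taylorCoeff_smul h0 k b n)).trans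
            ((Algebra.linearMap ℂ (Hol (Ux U))).map_smul k _)
        · have := subsingleton_oq hq h0
          exact Subsingleton.elim _ _ }
    (by
      by_cases h0 : (0 : ℂ) ∈ Ux U
      · refine Subtype.ext (QSeries.ext fun n => ?_)
        refine (congrArg (algebraMap ℂ (Hol (Ux U))) (taylorCoeff_one h0 n)).trans ?_
        refine Eq.trans ?_ (QSeries.coeff_one n).symm
        split_ifs <;> simp
      · have := subsingleton_oq hq h0
        exact Subsingleton.elim _ _)
    (fun b d => by
      by_cases h0 : (0 : ℂ) ∈ Ux U
      · refine Subtype.ext (QSeries.ext fun n => ?_)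
        refine (congrArg (algebraMap ℂ (Hol (Ux U))) (taylorCoeff_mul h0 b d n)).trans ?_
        rw [map_sum]
        refine Finset.sum_congr rfl fun p _ => ?_
        rw [map_mul]
        exact congrArg _ (AlgHom.commutes (scale U p.1) _).symm
      · have := subsingleton_oq hq h0
        exact Subsingleton.elim _ _)

theorem coeff_iotaY (b : Hol (Uy U)) (n : ℕ) :
    (iotaY hq U b).1.coeff n = algebraMap ℂ (Hol (Ux U)) (taylorCoeff b n) := rfl

theorem continuous_iotaY : Continuous (iotaY hq U) := by
  refine continuous_linearMap_hol (withSeminorms_oq hq U) (iotaY hq U).toLinearMap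
    fun ⟨K, ρ⟩ => ?_
  obtain ⟨L, C, h⟩ := exists_tsum_taylorCoeff_le ρ
  exact ⟨L, C, fun b =>
    (oqSeminorm_constSeries_le hq _ (summable_taylorCoeff b) K ρ).trans (h b).2⟩

/-- The restriction `f ↦ f₀` to the `x`-axis, as a homomorphism: only `f₀ g₀` contributes to the
coefficient of `y⁰` in `f g`. -/
def restrictX (U : Opens (QPlane q)) : Oq hq U →ₐ[ℂ] Hol (Ux U) :=
  AlgHom.ofLinearMap (coeffₗ hq U 0) rfl fun f g => by
    have h : coeffₗ hq U 0 (f * g) = _ := QSeries.coeff_mul f.1 g.1 0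
    rw [h, Finset.HasAntidiagonal.antidiagonal_zero, Finset.sum_singleton, scale_zero]
    rfl

theorem continuous_restrictX : Continuous (restrictX hq U) := continuous_coeffₗ hq 0

theorem norm_coeff_apply_le (f : Oq hq U) {K : Compacts (Ux U)} {z : Ux U} (hz : z ∈ K)
    (ρ : Radius U) (n : ℕ) :
    ‖(f.1.coeff n).1 z‖ * (ρ.1 : ℝ) ^ n ≤ supNorm K (f.1.coeff n) * (ρ.1 : ℝ) ^ n :=
  mul_le_mul_of_nonneg_right (norm_apply_le_supNorm _ hz) (by positivity)

theorem exists_compacts_mem {X : Type*} [TopologicalSpace X] (z : X) : ∃ K : Compacts X, z ∈ K :=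
  ⟨⟨{z}, isCompact_singleton⟩, rfl⟩

theorem summable_coeff_apply (f : Oq hq U) (z : Ux U) (ρ : Radius U) :
    Summable fun n => ‖(f.1.coeff n).1 z‖ * (ρ.1 : ℝ) ^ n := by
  obtain ⟨K, hK⟩ := exists_compacts_mem z
  exact Summable.of_nonneg_of_le (fun n => by positivity) (norm_coeff_apply_le hq f hK ρ) (f.2 K ρ)

/-- Evaluating a series at a point of the compact set is dominated by the seminorm. -/
theorem norm_le_oqSeminorm_of_hasSum {f : Oq hq U} {K : Compacts (Ux U)} {z : Ux U} (hz : z ∈ K)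
    {ρ : Radius U} {w : ℂ} (hw : ‖w‖ ≤ ρ.1) {s : ℂ}
    (hs : HasSum (fun n => (f.1.coeff n).1 z * w ^ n) s) : ‖s‖ ≤ oqSeminorm hq U K ρ f := by
  rw [← hs.tsum_eq]
  refine tsum_of_norm_bounded (hasSum_oqSeminorm hq K ρ f) fun n => ?_
  rw [norm_mul, norm_pow]
  refine le_trans ?_ (norm_coeff_apply_le hq f hz ρ n)
  gcongr

/-- The restriction `f ↦ ∑ fₙ(0) yⁿ` to the `y`-axis. It is a homomorphism because the dilations
`x ↦ qⁱ x` fix the origin. -/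
def restrictY (h0 : (0 : ℂ) ∈ Ux U) : Oq hq U →ₐ[ℂ] Hol (Uy U) :=
  let R : Oq hq U → Hol (Uy U) := fun f =>
    holOfSeries (fun n => (f.1.coeff n).1 ⟨0, h0⟩) (summable_coeff_apply hq f ⟨0, h0⟩)
  have hR : ∀ f (w : Uy U), HasSum (fun n => (f.1.coeff n).1 ⟨0, h0⟩ * (w : ℂ) ^ n) ((R f).1 w) :=
    fun f => hasSum_holOfSeries _ (summable_coeff_apply hq f ⟨0, h0⟩)
  AlgHom.ofLinearMap
    { toFun := R
      map_add' := fun f g => Subtype.ext <| ContinuousMap.ext fun w =>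
        (hR (f + g) w).unique <| ((hR f w).add (hR g w)).congr_fun fun n => add_mul _ _ _
      map_smul' := fun k f => Subtype.ext <| ContinuousMap.ext fun w =>
        (hR (k • f) w).unique <| ((hR f w).mul_left k).congr_fun fun n => mul_assoc _ _ _ }
    (Subtype.ext <| ContinuousMap.ext fun w => by
      refine (hR 1 w).unique ?_
      convert! hasSum_single
        (f := fun n => (QSeries.coeff (1 : QSeries U) n).1 ⟨0, h0⟩ * (w : ℂ) ^ n) 0 ?_
      · simp [QSeries.coeff_one]
      · intro n hn
        simp [QSeries.coeff_one, hn])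
    (fun f g => Subtype.ext <| ContinuousMap.ext fun w => by
      refine (hR (f * g) w).unique ?_
      refine (hasSum_cauchyProduct (summable_mul_pow (summable_coeff_apply hq f ⟨0, h0⟩) w)
        (summable_mul_pow (summable_coeff_apply hq g ⟨0, h0⟩) w) (hR f w) (hR g w)).congr_fun
        fun n => ?_
      congr 1
      have h : (f * g).1.coeff n = _ := QSeries.coeff_mul f.1 g.1 n
      rw [h]
      simp only [AddSubmonoidClass.coe_finsetSum, ContinuousMap.coe_sum, Finset.sum_apply]
      refine Finset.sum_congr rfl fun p _ => ?_
      change (f.1.coeff p.1).1 ⟨0, h0⟩ * (g.1.coeff p.2).1 (scaleMap U p.1 ⟨0, h0⟩) = _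
      congr 2
      exact Subtype.ext (by simp [scaleMap]))

theorem hasSum_restrictY (h0 : (0 : ℂ) ∈ Ux U) (f : Oq hq U) (w : Uy U) :
    HasSum (fun n => (f.1.coeff n).1 ⟨0, h0⟩ * (w : ℂ) ^ n) ((restrictY hq h0 f).1 w) :=
  hasSum_holOfSeries _ (summable_coeff_apply hq f ⟨0, h0⟩) w

theorem taylorCoeff_restrictY (h0 : (0 : ℂ) ∈ Ux U) (f : Oq hq U) (n : ℕ) :
    taylorCoeff (restrictY hq h0 f) n = (f.1.coeff n).1 ⟨0, h0⟩ :=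
  congrFun (taylorCoeff_unique h0 (hasSum_restrictY hq h0 f)) n

theorem supNorm_restrictY_le (h0 : (0 : ℂ) ∈ Ux U) {K : Compacts (Ux U)} (hK : ⟨0, h0⟩ ∈ K)
    {L : Compacts (Uy U)} {ρ : Radius U} (hρ : L ≤ closedDisk ρ) (f : Oq hq U) :
    supNorm L (restrictY hq h0 f) ≤ oqSeminorm hq U K ρ f := by
  have hC : 0 ≤ oqSeminorm hq U K ρ f := apply_nonneg _ _
  rw [supNorm_le_iff hC]
  exact fun w hw => norm_le_oqSeminorm_of_hasSum hq hK (mem_closedDisk.1 (hρ hw))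
    (hasSum_restrictY hq h0 f w)

theorem continuous_restrictY (h0 : (0 : ℂ) ∈ Ux U) : Continuous (restrictY hq h0) := by
  refine continuous_of_supNorm_le (restrictY hq h0).toLinearMap fun L => ?_
  obtain ⟨ρ, hρ⟩ := exists_le_closedDisk h0 L
  obtain ⟨K, hK⟩ := exists_compacts_mem (⟨0, h0⟩ : Ux U)
  exact ⟨_, continuous_oqSeminorm hq K ρ, supNorm_restrictY_le hq h0 hK hρ⟩

theorem restrictX_iotaX (a : Hol (Ux U)) : restrictX hq U (iotaX hq U a) = a :=
  (coeff_monomial hq 0 a 0).trans (if_pos rfl)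

theorem restrictY_iotaY (h0 : (0 : ℂ) ∈ Ux U) (b : Hol (Uy U)) :
    restrictY hq h0 (iotaY hq U b) = b :=
  Subtype.ext <| ContinuousMap.ext fun w =>
    (hasSum_restrictY hq h0 (iotaY hq U b) w).unique (hasSum_taylorCoeff b w)

theorem restrictX_iotaY (h0 : (0 : ℂ) ∈ Ux U) (b : Hol (Uy U)) :
    restrictX hq U (iotaY hq U b) =
      algebraMap ℂ (Hol (Ux U)) (b.1 ⟨0, zero_mem_Uy_iff.2 h0⟩) := by
  refine congrArg (algebraMap ℂ (Hol (Ux U))) ?_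
  refine HasSum.unique ?_ (hasSum_taylorCoeff b ⟨0, zero_mem_Uy_iff.2 h0⟩)
  convert! hasSum_single (f := fun n => taylorCoeff b n * (0 : ℂ) ^ n) 0 ?_
  · simp
  · intro n hn
    simp [hn]

theorem restrictY_iotaX (h0 : (0 : ℂ) ∈ Ux U) (a : Hol (Ux U)) :
    restrictY hq h0 (iotaX hq U a) = algebraMap ℂ (Hol (Uy U)) (a.1 ⟨0, h0⟩) := by
  refine Subtype.ext (ContinuousMap.ext fun w => ?_)
  refine (hasSum_restrictY hq h0 (iotaX hq U a) w).unique ?_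
  simp only [iotaX_apply, coeff_monomial]
  convert! hasSum_single (f := fun n => (if n = 0 then a else 0 : Hol (Ux U)).1 ⟨0, h0⟩ *
    (w : ℂ) ^ n) 0 ?_
  · simp [Algebra.algebraMap_eq_smul_one]
  · intro n hn
    simp [hn]

end Oq

/-! ### The Jacobson radical -/

/-- An algebra homomorphism to `ℂ` vanishes on the Jacobson radical. -/
theorem map_eq_zero_of_mem_jacobson {A : Type*} [Ring A] [Algebra ℂ A] (φ : A →ₐ[ℂ] ℂ) {x : A}
    (hx : x ∈ Ring.jacobson A) : φ x = 0 := by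
  by_contra h
  rw [← Ideal.jacobson_bot, Ideal.mem_jacobson_iff] at hx
  -- for this multiplier, `φ` annihilates `1 + y x`
  obtain ⟨z, hz⟩ := hx (algebraMap ℂ A (-(φ x)⁻¹))
  have h1 := congrArg φ (Ideal.mem_bot.1 hz)
  simp only [map_sub, map_add, map_mul, AlgHom.commutes, map_one, map_zero,
    Algebra.algebraMap_self, RingHom.id_apply] at h1
  field_simp at h1
  simp at h1

/-- Evaluation of holomorphic functions at a point. -/
def evalHol {V : Set ℂ} (z : V) : Hol V →ₐ[ℂ] ℂ where
  toFun a := a.1 z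
  map_one' := rfl
  map_mul' _ _ := rfl
  map_zero' := rfl
  map_add' _ _ := rfl
  commutes' _ := rfl

theorem continuous_evalHol {V : Set ℂ} (z : V) : Continuous (evalHol z) :=
  (continuous_eval_const z).comp continuous_subtype_val

/-- Every compact subset of `U_x` lies in one that is carried into itself by `x ↦ qⁱ x`. -/
theorem exists_invariant_compacts (hq : ‖q‖ < 1) (K : Compacts (Ux U)) :
    ∃ L : Compacts (Ux U), K ≤ L ∧ ∀ (i : ℕ), ∀ z ∈ L, scaleMap U i z ∈ L := by
  have h1 : IsCompact (insert (0 : ℂ) (Set.range fun n : ℕ => q ^ n)) :=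
    (tendsto_pow_atTop_nhds_zero_of_norm_lt_one hq).isCompact_insert_range
  have h2 : IsCompact (Subtype.val '' (K : Set (Ux U))) := K.isCompact.image continuous_subtype_val
  have h3 := (h1.prod h2).image continuous_mul
  have hsub : (fun p : ℂ × ℂ => p.1 * p.2) '' ((insert (0 : ℂ) (Set.range fun n : ℕ => q ^ n)) ×ˢ
      (Subtype.val '' (K : Set (Ux U)))) ⊆ Ux U := by
    rintro _ ⟨⟨t, z⟩, ⟨rfl | ⟨n, rfl⟩, ⟨z, hz, rfl⟩⟩, rfl⟩
    · simpa using (spiraling_of_mem U z.2).1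
    · exact (spiraling_of_mem U z.2).2 z z.2 n
  refine ⟨⟨_, IsEmbedding.subtypeVal.isCompact_preimage_iff (by simpa using hsub) |>.2 h3⟩, ?_, ?_⟩
  · intro z hz
    exact ⟨(1, z), ⟨Or.inr ⟨0, pow_zero q⟩, ⟨z, hz, rfl⟩⟩, one_mul _⟩
  · rintro i z ⟨⟨t, w⟩, ⟨ht, hw⟩, htw⟩
    refine ⟨(q ^ i * t, w), ⟨?_, hw⟩, ?_⟩
    · rcases ht with rfl | ⟨n, rfl⟩
      · exact Or.inl (mul_zero _)
      · exact Or.inr ⟨i + n, pow_add q i n⟩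
    · change q ^ i * t * w = q ^ i * z
      rw [mul_assoc]
      exact congrArg _ htw

/-- The dilated compact set `qᵐ K`. -/
def dilate (m : ℕ) (K : Compacts (Ux U)) : Compacts (Ux U) :=
  ⟨scaleMap U m '' K, K.isCompact.image (scaleMap U m).continuous⟩

/-- On `qᵐ L` the map `x ↦ qⁱ x` with `i ≥ 1` takes its values in `qᵐ⁺¹ L`, if `L` is invariant. -/
theorem supNorm_dilate_scale_le {L : Compacts (Ux U)}
    (hL : ∀ (i : ℕ), ∀ z ∈ L, scaleMap U i z ∈ L) (m : ℕ) {i : ℕ} (hi : i ≠ 0) (a : Hol (Ux U)) :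
    supNorm (dilate m L) (scale U i a) ≤ supNorm (dilate (m + 1) L) a := by
  refine (supNorm_le_iff (supNorm_nonneg _ a)).2 ?_
  rintro _ ⟨w, hw, rfl⟩
  refine norm_apply_le_supNorm (K := dilate (m + 1) L) a ⟨scaleMap U (i - 1) w, hL _ w hw, ?_⟩
  obtain ⟨j, rfl⟩ := Nat.exists_eq_succ_of_ne_zero hi
  refine Subtype.ext ?_
  simp only [scaleMap, ContinuousMap.coe_mk, Nat.succ_eq_add_one, Nat.add_sub_cancel]
  ring

/-- The dilated sets shrink to the origin, so the sup norms of a function vanishing there tend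
to `0`. -/
theorem tendsto_supNorm_dilate (hq : ‖q‖ < 1) (h0 : (0 : ℂ) ∈ Ux U) (L : Compacts (Ux U))
    {a : Hol (Ux U)} (ha : a.1 ⟨0, h0⟩ = 0) :
    Tendsto (fun m => supNorm (dilate m L) a) atTop (𝓝 0) := by
  rw [Metric.tendsto_atTop]
  intro ε hε
  obtain ⟨δ, hδ, hδε⟩ := Metric.continuous_iff.1 a.1.continuous ⟨0, h0⟩ (ε / 2) (half_pos hε)
  obtain ⟨R, hR⟩ := (L.isCompact.image continuous_subtype_val).isBounded.exists_norm_le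
  have ht : Tendsto (fun m : ℕ => ‖q‖ ^ m * R) atTop (𝓝 0) := by
    simpa using (tendsto_pow_atTop_nhds_zero_of_lt_one (norm_nonneg q) hq).mul_const R
  obtain ⟨N, hN⟩ := eventually_atTop.1 (ht.eventually (gt_mem_nhds hδ))
  refine ⟨N, fun m hm => ?_⟩
  rw [dist_zero_right, Real.norm_of_nonneg (supNorm_nonneg _ _)]
  refine lt_of_le_of_lt ((supNorm_le_iff (half_pos hε).le).2 ?_) (half_lt_self hε)
  rintro _ ⟨w, hw, rfl⟩
  have h := hδε (scaleMap U m w) (by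
    rw [Subtype.dist_eq, dist_zero_right]
    change ‖q ^ m * (w : ℂ)‖ < δ
    rw [norm_mul, norm_pow]
    exact lt_of_le_of_lt (by gcongr; exact hR _ ⟨w, hw, rfl⟩) (hN m hm))
  rw [ha, dist_zero_right] at h
  exact h.le

section Oq

variable (hq : ‖q‖ < 1)

theorem coeff_zero_eq_zero {g : Oq hq U} (hX : restrictX hq U g = 0) : g.1.coeff 0 = 0 := hX

theorem coeff_apply_zero_eq_zero {h0 : (0 : ℂ) ∈ Ux U} {g : Oq hq U}
    (hY : restrictY hq h0 g = 0) (n : ℕ) : (g.1.coeff n).1 ⟨0, h0⟩ = 0 := by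
  rw [← taylorCoeff_restrictY hq h0 g n, hY]
  have h := taylorCoeff_smul h0 0 (0 : Hol (Uy U)) n
  rwa [zero_smul, zero_mul] at h

theorem tendsto_oqSeminorm_dilate {h0 : (0 : ℂ) ∈ Ux U} {L : Compacts (Ux U)}
    (hL : ∀ (i : ℕ), ∀ z ∈ L, scaleMap U i z ∈ L) (ρ : Radius U) {g : Oq hq U}
    (hY : restrictY hq h0 g = 0) :
    Tendsto (fun m => oqSeminorm hq U (dilate m L) ρ g) atTop (𝓝 0) := by
  have hlim := tendsto_tsum_of_dominated_convergence (𝓕 := atTop)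
    (f := fun m n => supNorm (dilate m L) (g.1.coeff n) * (ρ.1 : ℝ) ^ n) (g := fun _ => (0 : ℝ))
    (bound := fun n => supNorm L (g.1.coeff n) * (ρ.1 : ℝ) ^ n) (g.2 L ρ)
    (fun n => by
      simpa using (tendsto_supNorm_dilate hq h0 L
        (coeff_apply_zero_eq_zero hq hY n)).mul_const ((ρ.1 : ℝ) ^ n))
    (Eventually.of_forall fun m n => by
      rw [Real.norm_of_nonneg (oqTerm_nonneg hq _ ρ g n)]
      refine mul_le_mul_of_nonneg_right (supNorm_mono ?_ _) (by positivity)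
      rintro _ ⟨w, hw, rfl⟩
      exact hL m w hw)
  simpa [oqSeminorm_apply] using hlim

/-- The quasinilpotency estimate: moving `y` past a function dilates its argument by `q`, so the
successive factors of `gᵏ` are evaluated on the sets `qʲ L`. -/
theorem oqSeminorm_pow_le {L : Compacts (Ux U)} (hL : ∀ (i : ℕ), ∀ z ∈ L, scaleMap U i z ∈ L)
    (ρ : Radius U) {g : Oq hq U} (hX : restrictX hq U g = 0) (k : ℕ) : ∀ m,
    oqSeminorm hq U (dilate m L) ρ (g ^ k) ≤
      ∏ j ∈ Finset.range k, oqSeminorm hq U (dilate (m + j) L) ρ g := by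
  induction k with
  | zero =>
    intro m
    rw [pow_zero, Finset.prod_range_zero, ← monomial_zero_one, oqSeminorm_monomial, pow_zero,
      mul_one]
    exact supNorm_one_le _
  | succ k ih =>
    intro m
    rw [pow_succ', Finset.prod_range_succ', mul_comm]
    refine (oqSeminorm_mul_le hq (L := dilate (m + 1) L) ρ g (g ^ k) fun i hi a => ?_).trans ?_
    · refine supNorm_dilate_scale_le hL m ?_ a
      rintro rfl
      exact hi (coeff_zero_eq_zero hq hX)
    · refine mul_le_mul_of_nonneg_left ?_ (apply_nonneg (oqSeminorm hq U (dilate m L) ρ) g)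
      refine (ih (m + 1)).trans_eq (Finset.prod_congr rfl fun j _ => ?_)
      rw [add_assoc, add_comm 1 j]

/-- The geometric series of an element vanishing on both axes converges: the norm of its `k`-th
power is bounded by a product of `k` factors that tend to `0`. -/
theorem summable_pow {h0 : (0 : ℂ) ∈ Ux U} {g : Oq hq U} (hX : restrictX hq U g = 0)
    (hY : restrictY hq h0 g = 0) : Summable fun k : ℕ => g ^ k := by
  refine summable_of_summable_seminorm (withSeminorms_oq hq U) fun ⟨K, ρ⟩ => ?_
  obtain ⟨L, hKL, hL⟩ := exists_invariant_compacts hq K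
  have hKL' : K ≤ dilate 0 L := fun z hz =>
    ⟨z, hKL hz, Subtype.ext (by simp [scaleMap])⟩
  have hs : Summable fun k => ∏ j ∈ Finset.range k, oqSeminorm hq U (dilate j L) ρ g := by
    refine summable_of_ratio_norm_eventually_le one_half_lt_one ?_
    filter_upwards [(tendsto_oqSeminorm_dilate hq hL ρ hY).eventually
      (gt_mem_nhds one_half_pos)] with k hk
    rw [Finset.prod_range_succ, norm_mul, mul_comm,
      Real.norm_of_nonneg (apply_nonneg (oqSeminorm hq U (dilate k L) ρ) g)]
    exact mul_le_mul_of_nonneg_right hk.le (norm_nonneg _)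
  refine Summable.of_nonneg_of_le (fun k => apply_nonneg _ _) (fun k => ?_) hs
  refine (oqSeminorm_mono hq hKL' le_rfl _).trans ?_
  simpa using oqSeminorm_pow_le hq hL ρ hX k 0

/-- The Jacobson radical consists of the series that vanish on both axes. -/
theorem mem_jacobson_oq_iff (h0 : (0 : ℂ) ∈ Ux U) (f : Oq hq U) :
    f ∈ Ring.jacobson (Oq hq U) ↔ restrictX hq U f = 0 ∧ restrictY hq h0 f = 0 := by
  constructor
  · -- the point evaluations on the axes are characters
    intro hf
    refine ⟨Subtype.ext (ContinuousMap.ext fun z => ?_),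
      Subtype.ext (ContinuousMap.ext fun w => ?_)⟩
    · exact map_eq_zero_of_mem_jacobson ((evalHol z).comp (restrictX hq U)) hf
    · exact map_eq_zero_of_mem_jacobson ((evalHol w).comp (restrictY hq h0)) hf
  · -- such series form an ideal, and the Neumann series inverts `1 + y f`
    rintro ⟨hX, hY⟩
    rw [← Ideal.jacobson_bot, Ideal.mem_jacobson_iff]
    intro y
    have hs : Summable fun k : ℕ => (-y * f) ^ k :=
      summable_pow hq (h0 := h0) (by rw [map_mul, hX, mul_zero]) (by rw [map_mul, hY, mul_zero])
    refine ⟨∑' k : ℕ, (-y * f) ^ k, ?_⟩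
    have h := hs.tsum_pow_mul_one_sub
    rw [neg_mul, sub_neg_eq_add, mul_add, mul_one, ← mul_assoc, ← neg_mul] at h
    rw [Ideal.mem_bot, add_comm _ (∑' k : ℕ, (-y * f) ^ k), h, sub_self]

theorem mem_jacobson_oq_iff_coeff (f : Oq hq U) : f ∈ Ring.jacobson (Oq hq U) ↔
    f.1.coeff 0 = 0 ∧ ∀ n : ℕ, 1 ≤ n → f.1.coeff n ∈ holVanish (Ux U) := by
  by_cases h0 : (0 : ℂ) ∈ Ux U
  · rw [mem_jacobson_oq_iff hq h0]
    constructor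
    · rintro ⟨hX, hY⟩
      refine ⟨hX, fun n _ z hz => ?_⟩
      rw [show z = ⟨0, h0⟩ from Subtype.ext hz]
      exact coeff_apply_zero_eq_zero hq hY n
    · rintro ⟨hX, hn⟩
      refine ⟨hX, Subtype.ext (ContinuousMap.ext fun w => ?_)⟩
      refine (hasSum_restrictY hq h0 f w).unique ?_
      have hz : ∀ n, (f.1.coeff n).1 ⟨0, h0⟩ = 0 := fun n => by
        rcases Nat.eq_zero_or_pos n with rfl | h
        · rw [hX]
          rfl
        · exact hn n h ⟨0, h0⟩ rfl
      simp only [hz, zero_mul]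
      exact hasSum_zero
  · have := subsingleton_oq hq h0
    have := subsingleton_hol_Ux h0
    rw [Subsingleton.elim f 0]
    refine ⟨fun _ => ⟨rfl, fun n _ => ?_⟩, fun _ => zero_mem _⟩
    exact zero_mem (holVanish (Ux U))

/-- Commutators vanish on both axes, as the restrictions take values in commutative algebras. -/
theorem commutator_mem_jacobson_oq (f g : Oq hq U) :
    f * g - g * f ∈ Ring.jacobson (Oq hq U) := by
  by_cases h0 : (0 : ℂ) ∈ Ux U
  · rw [mem_jacobson_oq_iff hq h0]
    constructor
    · rw [map_sub, map_mul, map_mul, mul_comm, sub_self]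
    · rw [map_sub, map_mul, map_mul, mul_comm, sub_self]
  · have := subsingleton_oq hq h0
    rw [Subsingleton.elim (f * g - g * f) 0]
    exact zero_mem _

end Oq

/-! ### The topological direct sum decomposition -/

section Oq

variable (hq : ‖q‖ < 1)

theorem mem_holVanish_Uy_iff (h0 : (0 : ℂ) ∈ Ux U) (b : Hol (Uy U)) :
    b ∈ holVanish (Uy U) ↔ b.1 ⟨0, zero_mem_Uy_iff.2 h0⟩ = 0 :=
  ⟨fun h => h _ rfl, fun h z hz => by rwa [show z = ⟨0, zero_mem_Uy_iff.2 h0⟩ from Subtype.ext hz]⟩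

/-- The component of `f` in the ideal of functions of `y` vanishing at the origin. -/
def yComponent (h0 : (0 : ℂ) ∈ Ux U) (f : Oq hq U) : Hol (Uy U) :=
  restrictY hq h0 f + algebraMap ℂ (Hol (Uy U)) (-(restrictX hq U f).1 ⟨0, h0⟩)

theorem continuous_yComponent (h0 : (0 : ℂ) ∈ Ux U) : Continuous (yComponent hq h0) := by
  have h1 : Continuous fun c : ℂ => algebraMap ℂ (Hol (Uy U)) c :=
    ContinuousMap.continuous_const'.subtype_mk _
  refine (continuous_restrictY hq h0).add (h1.comp ?_)
  exact ((continuous_evalHol ⟨0, h0⟩).comp (continuous_restrictX hq)).neg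

theorem restrictY_apply_zero (h0 : (0 : ℂ) ∈ Ux U) (f : Oq hq U) :
    (restrictY hq h0 f).1 ⟨0, zero_mem_Uy_iff.2 h0⟩ = (restrictX hq U f).1 ⟨0, h0⟩ := by
  refine (hasSum_restrictY hq h0 f ⟨0, zero_mem_Uy_iff.2 h0⟩).unique ?_
  convert! hasSum_single (f := fun n => (f.1.coeff n).1 ⟨0, h0⟩ * (0 : ℂ) ^ n) 0 ?_
  · rw [pow_zero, mul_one]
    rfl
  · intro n hn
    simp [hn]

theorem yComponent_mem (h0 : (0 : ℂ) ∈ Ux U) (f : Oq hq U) :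
    yComponent hq h0 f ∈ holVanish (Uy U) := by
  rw [mem_holVanish_Uy_iff h0]
  change (restrictY hq h0 f).1 ⟨0, zero_mem_Uy_iff.2 h0⟩ + -(restrictX hq U f).1 ⟨0, h0⟩ = 0
  rw [restrictY_apply_zero, add_neg_cancel]

theorem restrictX_iotaY_eq_zero (h0 : (0 : ℂ) ∈ Ux U) {b : Hol (Uy U)}
    (hb : b ∈ holVanish (Uy U)) : restrictX hq U (iotaY hq U b) = 0 := by
  rw [restrictX_iotaY hq h0, (mem_holVanish_Uy_iff h0 b).1 hb, map_zero]

/-- Subtracting the component in `x` and the component in `y` leaves an element of the radical. -/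
theorem sub_components_mem_jacobson (h0 : (0 : ℂ) ∈ Ux U) (f : Oq hq U) :
    f - iotaX hq U (restrictX hq U f) - iotaY hq U (yComponent hq h0 f) ∈
      Ring.jacobson (Oq hq U) := by
  rw [mem_jacobson_oq_iff hq h0, map_sub, map_sub, map_sub, map_sub, restrictX_iotaX,
    restrictX_iotaY_eq_zero hq h0 (yComponent_mem hq h0 f), restrictY_iotaX, restrictY_iotaY]
  constructor
  · rw [sub_self, sub_self]
  · rw [yComponent, map_neg, sub_sub, add_left_comm, add_neg_cancel, add_zero, sub_self]

/-- The topological direct sum decomposition of `𝒪_q(U)`. -/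
def decomposition (h0 : (0 : ℂ) ∈ Ux U) :
    (Hol (Ux U) × Ring.jacobson (Oq hq U) × holVanish (Uy U)) ≃L[ℂ] Oq hq U where
  toFun x := iotaX hq U x.1 + x.2.1.1 + iotaY hq U x.2.2.1
  map_add' x y := by
    change iotaX hq U (x.1 + y.1) + (x.2.1.1 + y.2.1.1) + iotaY hq U (x.2.2.1 + y.2.2.1) = _
    rw [map_add, map_add]
    abel
  map_smul' c x := by
    change iotaX hq U (c • x.1) + c • x.2.1.1 + iotaY hq U (c • x.2.2.1) = _
    rw [map_smul, map_smul, RingHom.id_apply, smul_add, smul_add]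
  invFun f := (restrictX hq U f, ⟨_, sub_components_mem_jacobson hq h0 f⟩,
    ⟨_, yComponent_mem hq h0 f⟩)
  left_inv x := by
    obtain ⟨a, ⟨r, hr⟩, ⟨b, hb⟩⟩ := x
    have hr' := (mem_jacobson_oq_iff hq h0 r).1 hr
    have hX : restrictX hq U (iotaX hq U a + r + iotaY hq U b) = a := by
      rw [map_add, map_add, restrictX_iotaX, hr'.1, restrictX_iotaY_eq_zero hq h0 hb, add_zero,
        add_zero]
    have hY : yComponent hq h0 (iotaX hq U a + r + iotaY hq U b) = b := by
      rw [yComponent, hX, map_add, map_add, restrictY_iotaX, hr'.2, restrictY_iotaY, add_zero,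
        map_neg, add_right_comm, add_neg_cancel, zero_add]
    refine Prod.ext hX (Prod.ext (Subtype.ext ?_) (Subtype.ext hY))
    change iotaX hq U a + r + iotaY hq U b - iotaX hq U (restrictX hq U _) -
      iotaY hq U (yComponent hq h0 _) = r
    rw [hX, hY]
    abel
  right_inv f := by
    change iotaX hq U _ + (f - _ - _) + iotaY hq U _ = f
    abel
  continuous_toFun :=
    (((continuous_iotaX hq).comp continuous_fst).add
      (continuous_subtype_val.comp (continuous_fst.comp continuous_snd))).add
      ((continuous_iotaY hq).comp (continuous_subtype_val.comp
        (continuous_snd.comp continuous_snd)))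
  continuous_invFun := by
    refine (continuous_restrictX hq).prodMk (Continuous.prodMk ?_ ?_)
    · exact ((continuous_id.sub ((continuous_iotaX hq).comp (continuous_restrictX hq))).sub
        ((continuous_iotaY hq).comp (continuous_yComponent hq h0))).subtype_mk _
    · exact (continuous_yComponent hq h0).subtype_mk _

/-- The image is the fixed-point set of a continuous projection. -/
theorem isClosed_range_iotaX : IsClosed (Set.range (iotaX hq U)) := by
  have h : Set.range (iotaX hq U) = {f | iotaX hq U (restrictX hq U f) = f} :=
    Set.ext fun f => ⟨by rintro ⟨a, rfl⟩; exact congrArg _ (restrictX_iotaX hq a),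
      fun h => ⟨_, h⟩⟩
  rw [h]
  exact isClosed_eq ((continuous_iotaX hq).comp (continuous_restrictX hq)) continuous_id

theorem isClosed_jacobson_oq (h0 : (0 : ℂ) ∈ Ux U) :
    IsClosed (Ring.jacobson (Oq hq U) : Set (Oq hq U)) := by
  have h : (Ring.jacobson (Oq hq U) : Set (Oq hq U)) =
      {f | restrictX hq U f = 0} ∩ {f | restrictY hq h0 f = 0} :=
    Set.ext fun f => mem_jacobson_oq_iff hq h0 f
  rw [h]
  exact (isClosed_eq (continuous_restrictX hq) continuous_const).inter
    (isClosed_eq (continuous_restrictY hq h0) continuous_const)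

theorem isClosed_image_iotaY (h0 : (0 : ℂ) ∈ Ux U) :
    IsClosed (iotaY hq U '' (holVanish (Uy U) : Set (Hol (Uy U)))) := by
  have h : iotaY hq U '' (holVanish (Uy U) : Set (Hol (Uy U))) =
      {f | iotaY hq U (restrictY hq h0 f) = f} ∩ {f | restrictX hq U f = 0} := by
    ext f
    constructor
    · rintro ⟨b, hb, rfl⟩
      exact ⟨congrArg _ (restrictY_iotaY hq h0 b), restrictX_iotaY_eq_zero hq h0 hb⟩
    · rintro ⟨h1, h2⟩
      refine ⟨restrictY hq h0 f, ?_, h1⟩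
      rw [SetLike.mem_coe, mem_holVanish_Uy_iff h0, restrictY_apply_zero,
        show restrictX hq U f = 0 from h2]
      rfl
  rw [h]
  exact (isClosed_eq ((continuous_iotaY hq).comp (continuous_restrictY hq h0))
    continuous_id).inter (isClosed_eq (continuous_restrictX hq) continuous_const)

end Oq

/-! ### Characters -/

/-- The coordinate function on `V`. -/
def coord (V : Set ℂ) : Hol V :=
  ⟨⟨Subtype.val, continuous_subtype_val⟩, id, differentiableOn_id, fun _ => rfl⟩

/-- The value of a character of `𝒪(V)` at the coordinate function lies in `V`: otherwise the
coordinate function minus this value is invertible. -/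
theorem character_coord_mem {V : Set ℂ} (ψ : Hol V →ₐ[ℂ] ℂ) : ψ (coord V) ∈ V := by
  by_contra h
  have hne : ∀ z ∈ V, z - ψ (coord V) ≠ 0 := fun z hz h' => h (by rwa [← sub_eq_zero.1 h'])
  have hd : DifferentiableOn ℂ (fun z => (z - ψ (coord V))⁻¹) V :=
    (differentiableOn_id.sub (differentiableOn_const _)).inv hne
  let b : Hol V := ⟨⟨V.domRestrict fun z => (z - ψ (coord V))⁻¹, hd.continuousOn.domRestrict⟩,
    _, hd, fun _ => rfl⟩
  have hb : (coord V + algebraMap ℂ (Hol V) (-ψ (coord V))) * b = 1 :=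
    Subtype.ext <| ContinuousMap.ext fun z => by
      change ((z : ℂ) + -ψ (coord V)) * ((z : ℂ) - ψ (coord V))⁻¹ = 1
      rw [← sub_eq_add_neg]
      exact mul_inv_cancel₀ (hne z z.2)
  have h1 := congrArg ψ hb
  rw [map_mul, map_add, AlgHom.commutes, map_one, Algebra.algebraMap_self, RingHom.id_apply,
    add_neg_cancel, zero_mul] at h1
  exact zero_ne_one h1

/-- Every character of `𝒪(V)` is a point evaluation, as `a - a(z₀)` is divisible by the coordinate
function minus `z₀`. -/
theorem character_eq_eval {V : Set ℂ} (hV : IsOpen V) (ψ : Hol V →ₐ[ℂ] ℂ) (a : Hol V) :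
    ψ a = a.1 ⟨ψ (coord V), character_coord_mem ψ⟩ := by
  have hmem := character_coord_mem ψ
  set z₀ := ψ (coord V) with hz₀
  obtain ⟨F, hF, haF⟩ := a.2
  have hd : DifferentiableOn ℂ (dslope F z₀) V :=
    (Complex.differentiableOn_dslope (hV.mem_nhds hmem)).2 hF
  let b : Hol V := ⟨⟨V.domRestrict (dslope F z₀), hd.continuousOn.domRestrict⟩,
    _, hd, fun _ => rfl⟩
  have hb : a = algebraMap ℂ (Hol V) (a.1 ⟨z₀, hmem⟩) +
      (coord V + algebraMap ℂ (Hol V) (-z₀)) * b :=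
    Subtype.ext <| ContinuousMap.ext fun z => by
      change a.1 z = a.1 ⟨z₀, hmem⟩ + ((z : ℂ) + -z₀) * dslope F z₀ z
      have := sub_smul_dslope F z₀ (z : ℂ)
      rw [smul_eq_mul] at this
      rw [← sub_eq_add_neg, this, haF, haF]
      ring
  have h1 := congrArg ψ hb
  rw [map_add, map_mul, map_add, AlgHom.commutes, AlgHom.commutes, ← hz₀, Algebra.algebraMap_self,
    RingHom.id_apply, RingHom.id_apply, add_neg_cancel, zero_mul, add_zero] at h1
  exact h1

section Characters

variable (hq : ‖q‖ < 1)

theorem snd_mem_Uy (γ : U) : γ.1.1.2 ∈ Uy U := by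
  obtain ⟨⟨⟨a, b⟩, h⟩, hγ⟩ := γ
  rcases h with h | h
  · simp only at h
    subst h
    exact (zero_mem_Uy_iff (U := U)).2 (spiraling_of_mem U (z := a) hγ).1
  · simp only at h
    subst h
    exact hγ

/-- The evaluation at a point of `U` is a continuous character. -/
theorem exists_character (γ : U) : ∃ φ : Oq hq U →A[ℂ] ℂ, ∀ f : Oq hq U,
    HasSum (fun n => (f.1.coeff n).1 ⟨γ.1.1.1, fst_mem_Ux U γ⟩ * γ.1.1.2 ^ n) (φ f) := by
  have hx := fst_mem_Ux U γ
  have h0 := (spiraling_of_mem U hx).1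
  have hy := snd_mem_Uy γ
  rcases γ.1.2 with h | h
  · refine ⟨⟨(evalHol ⟨_, hx⟩).comp (restrictX hq U),
      (continuous_evalHol _).comp (continuous_restrictX hq)⟩, fun f => ?_⟩
    rw [h]
    convert! hasSum_single (f := fun n => (f.1.coeff n).1 ⟨γ.1.1.1, hx⟩ * (0 : ℂ) ^ n) 0 ?_
    · rw [pow_zero, mul_one]
      rfl
    · intro n hn
      simp [hn]
  · refine ⟨⟨(evalHol ⟨_, hy⟩).comp (restrictY hq h0),
      (continuous_evalHol _).comp (continuous_restrictY hq h0)⟩, fun f => ?_⟩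
    have hz : (⟨γ.1.1.1, hx⟩ : Ux U) = ⟨0, h0⟩ := Subtype.ext h
    rw [hz]
    exact hasSum_restrictY hq h0 f ⟨_, hy⟩

theorem hasSum_monomial_apply (z : Ux U) (w : ℂ) (n : ℕ) (a : Hol (Ux U)) :
    HasSum (fun m => ((monomial hq U n a).1.coeff m).1 z * w ^ m) (a.1 z * w ^ n) := by
  convert! hasSum_single (f := fun m => ((monomial hq U n a).1.coeff m).1 z * w ^ m) n ?_
  · rw [coeff_monomial, if_pos rfl]
  · intro m hm
    rw [coeff_monomial, if_neg hm]
    exact zero_mul _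

/-- The coordinate function of the `y`-axis corresponds to the generator `y`. -/
theorem iotaY_coord (h0 : (0 : ℂ) ∈ Ux U) : iotaY hq U (coord (Uy U)) = monomial hq U 1 1 := by
  refine Subtype.ext (QSeries.ext fun n => ?_)
  rw [coeff_iotaY, coeff_monomial, taylorCoeff_unique h0 (c := fun n => if n = 1 then 1 else 0)]
  · beta_reduce
    split_ifs
    · exact map_one (algebraMap ℂ (Hol (Ux U)))
    · exact map_zero (algebraMap ℂ (Hol (Ux U)))
  · intro w
    convert! hasSum_single (f := fun n => (if n = 1 then (1 : ℂ) else 0) * (w : ℂ) ^ n) 1 ?_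
    · simp [coord]
    · intro n hn
      simp [hn]

theorem monomial_one_pow (n : ℕ) : monomial hq U 1 1 ^ n = monomial hq U n 1 := by
  induction n with
  | zero => rw [pow_zero, monomial_zero_one]
  | succ n ih => rw [pow_succ, ih, monomial_mul_monomial, map_one, mul_one]

theorem monomial_eq_iotaX_mul_pow (n : ℕ) (a : Hol (Ux U)) :
    monomial hq U n a = iotaX hq U a * monomial hq U 1 1 ^ n := by
  rw [monomial_one_pow, iotaX_apply, monomial_mul_monomial, map_one, mul_one, zero_add]

/-- The relation `y x = q x y` forces one of the two coordinates of a character to vanish. -/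
theorem character_coord_mul_eq_zero (φ : Oq hq U →ₐ[ℂ] ℂ) :
    φ (iotaX hq U (coord (Ux U))) * φ (monomial hq U 1 1) = 0 := by
  have hs : scale U 1 (coord (Ux U)) = q • coord (Ux U) :=
    Subtype.ext <| ContinuousMap.ext fun z => by
      change q ^ 1 * (z : ℂ) = q * z
      rw [pow_one]
  have h : monomial hq U 1 1 * iotaX hq U (coord (Ux U)) =
      q • (iotaX hq U (coord (Ux U)) * monomial hq U 1 1) := by
    rw [iotaX_apply, monomial_mul_monomial, monomial_mul_monomial, hs, scale_zero, one_mul, mul_one,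
      map_smul]
  have h1 := congrArg φ h
  rw [map_mul, map_smul, map_mul, smul_eq_mul, mul_comm (φ (monomial hq U 1 1))] at h1
  have hq1 : q ≠ 1 := fun h => by simp [h] at hq
  have h2 : (1 - q) * (φ (iotaX hq U (coord (Ux U))) * φ (monomial hq U 1 1)) = 0 := by
    rw [sub_mul, one_mul, ← h1, sub_self]
  exact (mul_eq_zero.1 h2).resolve_left (sub_ne_zero.2 hq1.symm)

/-- Every continuous character is the evaluation at a point of `U`. -/
theorem exists_point_of_character (φ : Oq hq U →A[ℂ] ℂ) : ∃ γ : U, ∀ f : Oq hq U,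
    HasSum (fun n => (f.1.coeff n).1 ⟨γ.1.1.1, fst_mem_Ux U γ⟩ * γ.1.1.2 ^ n) (φ f) := by
  let φ' : Oq hq U →ₐ[ℂ] ℂ := φ
  have hx := character_coord_mem (φ'.comp (iotaX hq U))
  have h0 := (spiraling_of_mem U hx).1
  have hy : φ' (monomial hq U 1 1) ∈ Uy U := by
    rw [← iotaY_coord hq h0]
    exact character_coord_mem (φ'.comp (iotaY hq U))
  have hxy := character_coord_mul_eq_zero hq φ'
  have hU : ∃ h,
      (⟨(φ' (iotaX hq U (coord (Ux U))), φ' (monomial hq U 1 1)), h⟩ : QPlane q) ∈ U := by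
    rcases mul_eq_zero.1 hxy with h | h
    · refine ⟨Or.inr h, ?_⟩
      change inY q (φ' (monomial hq U 1 1)) ∈ U at hy
      have he : (⟨(φ' (iotaX hq U (coord (Ux U))), φ' (monomial hq U 1 1)), Or.inr h⟩ : QPlane q) =
          inY q (φ' (monomial hq U 1 1)) :=
        Subtype.ext (Prod.ext h rfl)
      exact he ▸ hy
    · refine ⟨Or.inl h, ?_⟩
      change inX q (φ' (iotaX hq U (coord (Ux U)))) ∈ U at hx
      have he : (⟨(φ' (iotaX hq U (coord (Ux U))), φ' (monomial hq U 1 1)), Or.inl h⟩ : QPlane q) =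
          inX q (φ' (iotaX hq U (coord (Ux U)))) :=
        Subtype.ext (Prod.ext rfl h)
      exact he ▸ hx
  obtain ⟨hxy', hU⟩ := hU
  refine ⟨⟨_, hU⟩, fun f => ?_⟩
  refine ((hasSum_monomial hq f).map φ φ.continuous).congr_fun fun n => ?_
  have h1 : φ' (monomial hq U n (f.1.coeff n)) =
      φ' (iotaX hq U (f.1.coeff n)) * φ' (monomial hq U 1 1) ^ n := by
    rw [monomial_eq_iotaX_mul_pow, map_mul, map_pow]
  refine Eq.trans ?_ h1.symm
  exact congrArg (· * _)
    (character_eq_eval (isOpen_Ux_standard U) (φ'.comp (iotaX hq U)) (f.1.coeff n)).symm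

/-- Evaluations at distinct points differ on `x` or on `y`, so that the points of `U` correspond
bijectively to the continuous characters. -/
theorem exists_spectrum_equiv : ∃ ev : U ≃ (Oq hq U →A[ℂ] ℂ), ∀ (γ : U) (f : Oq hq U),
    HasSum (fun n => (f.1.coeff n).1 ⟨γ.1.1.1, fst_mem_Ux U γ⟩ * γ.1.1.2 ^ n) (ev γ f) := by
  choose ev hev using fun γ : U => exists_character hq γ
  refine ⟨Equiv.ofBijective ev ⟨fun γ γ' h => ?_, fun φ => ?_⟩, hev⟩
  · have key : ∀ (n : ℕ) (a : Hol (Ux U)), a.1 ⟨γ.1.1.1, fst_mem_Ux U γ⟩ * γ.1.1.2 ^ n =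
        a.1 ⟨γ'.1.1.1, fst_mem_Ux U γ'⟩ * γ'.1.1.2 ^ n := fun n a => by
      rw [← (hev γ _).unique (hasSum_monomial_apply hq _ γ.1.1.2 n a), h]
      exact (hev γ' _).unique (hasSum_monomial_apply hq _ γ'.1.1.2 n a)
    refine Subtype.ext (Subtype.ext (Prod.ext ?_ ?_))
    · have := key 0 (coord (Ux U))
      rwa [pow_zero, pow_zero, mul_one, mul_one] at this
    · have := key 1 1
      rw [pow_one, pow_one] at this
      exact (one_mul _).symm.trans (this.trans (one_mul _))
  · obtain ⟨γ, hγ⟩ := exists_point_of_character hq φ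
    exact ⟨γ, ContinuousAlgHom.ext fun f => (hev γ f).unique (hγ f)⟩

end Characters

/-! ### The completed projective tensor product -/

/-- A continuous bilinear map on spaces of holomorphic functions is bounded with respect to each
continuous seminorm of its target. -/
theorem exists_seminorm_bilin_le {V W : Set ℂ} {H : Type*} [AddCommGroup H] [Module ℂ H]
    [TopologicalSpace H] {B : Hol V →ₗ[ℂ] Hol W →ₗ[ℂ] H}
    (hB : Continuous fun p : Hol V × Hol W => B p.1 p.2) {s : Seminorm ℂ H} (hs : Continuous s) :
    ∃ (K : Compacts V) (L : Compacts W) (C : ℝ), 0 ≤ C ∧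
      ∀ a b, s (B a b) ≤ C * supNorm K a * supNorm L b := by
  have hN : {p : Hol V × Hol W | s (B p.1 p.2) < 1} ∈ 𝓝 (0 : Hol V × Hol W) :=
    (isOpen_lt (hs.comp hB) continuous_const).mem_nhds (by simp)
  obtain ⟨N, hN0, N', hN0', hsub⟩ := mem_nhds_prod_iff.1 hN
  obtain ⟨K, ε, hε, hK⟩ := exists_supNorm_lt_subset hN0
  obtain ⟨L, δ, hδ, hL⟩ := exists_supNorm_lt_subset hN0'
  refine ⟨K, L, (ε * δ)⁻¹, by positivity, fun a b => ?_⟩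
  -- rescale `a` and `b` into the neighbourhoods; `η > 0` guards against vanishing sup norms, and
  -- tends to `0` at the end
  have scaled : ∀ {X : Set ℂ} (M : Compacts X) (f : Hol X) {ε η : ℝ}, 0 < ε → 0 < η →
      supNorm M (((ε / (supNorm M f + η) : ℝ) : ℂ) • f) < ε := fun M f ε η hε hη => by
    have h0 := supNorm_nonneg M f
    rw [supNorm_smul, Complex.norm_real, Real.norm_of_nonneg (by positivity), div_mul_eq_mul_div,
      div_lt_iff₀ (by positivity)]
    exact mul_lt_mul_of_pos_left (lt_add_of_pos_right _ hη) hε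
  have key : ∀ η : ℝ, 0 < η →
      s (B a b) ≤ (ε * δ)⁻¹ * (supNorm K a + η) * (supNorm L b + η) := fun η hη => by
    have ha := supNorm_nonneg K a
    have hb := supNorm_nonneg L b
    have h := @hsub (((ε / (supNorm K a + η) : ℝ) : ℂ) • a, ((δ / (supNorm L b + η) : ℝ) : ℂ) • b)
      ⟨hK _ (scaled K a hε hη), hL _ (scaled L b hδ hη)⟩
    have h' : ε / (supNorm K a + η) * (δ / (supNorm L b + η) * s (B a b)) < 1 := by
      have h2 : s (B (((ε / (supNorm K a + η) : ℝ) : ℂ) • a)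
        (((δ / (supNorm L b + η) : ℝ) : ℂ) • b)) < 1 := h
      rwa [map_smul B, LinearMap.smul_apply, map_smul (B a), map_smul_eq_mul, map_smul_eq_mul,
        Complex.norm_real, Complex.norm_real, Real.norm_of_nonneg (by positivity),
        Real.norm_of_nonneg (by positivity)] at h2
    have h3 : ε / (supNorm K a + η) * (δ / (supNorm L b + η) * s (B a b)) =
        s (B a b) / ((ε * δ)⁻¹ * (supNorm K a + η) * (supNorm L b + η)) := by
      field_simp
    rw [h3, div_lt_one (by positivity)] at h'
    exact h'.le
  have hlim : Tendsto (fun η : ℝ => (ε * δ)⁻¹ * (supNorm K a + η) * (supNorm L b + η)) (𝓝[>] 0)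
      (𝓝 ((ε * δ)⁻¹ * supNorm K a * supNorm L b)) := by
    refine Tendsto.mono_left (Continuous.tendsto' (by fun_prop) _ _ ?_) nhdsWithin_le_nhds
    rw [add_zero, add_zero]
  exact ge_of_tendsto hlim (eventually_mem_nhdsWithin.mono key)

theorem supNorm_coord_pow_le (ρ : Radius U) (n : ℕ) :
    supNorm (closedDisk ρ) (coord (Uy U) ^ n) ≤ (ρ.1 : ℝ) ^ n :=
  (supNorm_le_iff (by positivity)).2 fun w hw => by
    change ‖(w : ℂ) ^ n‖ ≤ _
    rw [norm_pow]
    exact pow_le_pow_left₀ (norm_nonneg _) (mem_closedDisk.1 hw) n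

section Oq

variable (hq : ‖q‖ < 1)

theorem iotaY_coord_pow (h0 : (0 : ℂ) ∈ Ux U) (n : ℕ) :
    iotaY hq U (coord (Uy U) ^ n) = monomial hq U n 1 := by
  rw [map_pow, iotaY_coord hq h0, monomial_one_pow]

theorem mulMap_coord_pow (h0 : (0 : ℂ) ∈ Ux U) (n : ℕ) (a : Hol (Ux U)) :
    mulMap (iotaX hq U) (iotaY hq U) a (coord (Uy U) ^ n) = monomial hq U n a := by
  change iotaX hq U a * iotaY hq U (coord (Uy U) ^ n) = _
  rw [iotaY_coord_pow hq h0, ← monomial_one_pow, ← monomial_eq_iotaX_mul_pow]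

/-- The Taylor series of `b` converges to `b` in `𝒪(U_y)`. -/
theorem hasSum_taylorCoeff_smul_coord_pow (hq : ‖q‖ < 1) (h0 : (0 : ℂ) ∈ Ux U) (b : Hol (Uy U)) :
    HasSum (fun n => taylorCoeff b n • coord (Uy U) ^ n) b := by
  have h := (hasSum_monomial hq (iotaY hq U b)).map (restrictY hq h0) (continuous_restrictY hq h0)
  rw [restrictY_iotaY] at h
  refine h.congr_fun fun n => ?_
  change _ = restrictY hq h0 (monomial hq U n ((iotaY hq U b).1.coeff n))
  rw [coeff_iotaY, Algebra.algebraMap_eq_smul_one, map_smul, map_smul, ← iotaY_coord_pow hq h0,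
    restrictY_iotaY]

/-- A continuous bilinear map on `𝒪(U_x) × 𝒪(U_y)` is determined by its values at the pairs
`(a, yⁿ)`. -/
theorem eq_of_coord_pow (hq : ‖q‖ < 1) {H : Type*} [AddCommGroup H] [Module ℂ H]
    [TopologicalSpace H] [T2Space H] {B B' : Hol (Ux U) →ₗ[ℂ] Hol (Uy U) →ₗ[ℂ] H}
    (h0 : (0 : ℂ) ∈ Ux U)
    (hB : Continuous fun p : Hol (Ux U) × Hol (Uy U) => B p.1 p.2)
    (hB' : Continuous fun p : Hol (Ux U) × Hol (Uy U) => B' p.1 p.2)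
    (h : ∀ a n, B a (coord (Uy U) ^ n) = B' a (coord (Uy U) ^ n)) (a : Hol (Ux U))
    (b : Hol (Uy U)) : B a b = B' a b := by
  have hb := hasSum_taylorCoeff_smul_coord_pow hq h0 b
  have h1 := hb.map (B a) (hB.comp (continuous_const.prodMk continuous_id))
  have h2 := hb.map (B' a) (hB'.comp (continuous_const.prodMk continuous_id))
  refine h1.unique (h2.congr_fun fun n => ?_)
  change B a _ = B' a _
  rw [map_smul, map_smul, h]

/-- The terms `B(fₙ, yⁿ)` are dominated by those of a seminorm `p_{K,ρ}`. -/
theorem exists_summable_lift_le {H : Type*} [AddCommGroup H] [Module ℂ H] [TopologicalSpace H]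
    {B : Hol (Ux U) →ₗ[ℂ] Hol (Uy U) →ₗ[ℂ] H} (h0 : (0 : ℂ) ∈ Ux U)
    (hB : Continuous fun p : Hol (Ux U) × Hol (Uy U) => B p.1 p.2) {s : Seminorm ℂ H}
    (hs : Continuous s) : ∃ (K : Compacts (Ux U)) (ρ : Radius U) (C : ℝ), 0 ≤ C ∧
      ∀ (f : Oq hq U) (n : ℕ), s (B (f.1.coeff n) (coord (Uy U) ^ n)) ≤
        C * (supNorm K (f.1.coeff n) * (ρ.1 : ℝ) ^ n) := by
  obtain ⟨K, L, C, hC, h⟩ := exists_seminorm_bilin_le hB hs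
  obtain ⟨ρ, hρ⟩ := exists_le_closedDisk h0 L
  refine ⟨K, ρ, C, hC, fun f n => (h _ _).trans ?_⟩
  rw [← mul_assoc]
  exact mul_le_mul_of_nonneg_left ((supNorm_mono hρ _).trans (supNorm_coord_pow_le ρ n))
    (mul_nonneg hC (supNorm_nonneg _ _))

theorem summable_lift {H : Type*} [AddCommGroup H] [Module ℂ H] [UniformSpace H]
    [IsUniformAddGroup H] [PolynormableSpace ℂ H] [CompleteSpace H]
    {B : Hol (Ux U) →ₗ[ℂ] Hol (Uy U) →ₗ[ℂ] H} (h0 : (0 : ℂ) ∈ Ux U)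
    (hB : Continuous fun p : Hol (Ux U) × Hol (Uy U) => B p.1 p.2) (f : Oq hq U) :
    Summable fun n => B (f.1.coeff n) (coord (Uy U) ^ n) := by
  refine summable_of_summable_seminorm (PolynormableSpace.withSeminorms ℂ H) fun s => ?_
  obtain ⟨K, ρ, C, -, h⟩ := exists_summable_lift_le hq h0 hB s.2
  exact Summable.of_nonneg_of_le (fun n => apply_nonneg s.1 _) (h f) ((f.2 K ρ).mul_left C)

variable {H : Type*} [AddCommGroup H] [Module ℂ H] [UniformSpace H] [IsUniformAddGroup H]
  [ContinuousSMul ℂ H] [PolynormableSpace ℂ H] [CompleteSpace H] [T2Space H]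
  {B : Hol (Ux U) →ₗ[ℂ] Hol (Uy U) →ₗ[ℂ] H}

/-- The linear map `∑ fₙ(x) yⁿ ↦ ∑ B(fₙ, yⁿ)` induced by a continuous bilinear map `B`. -/
def lift (h0 : (0 : ℂ) ∈ Ux U)
    (hB : Continuous fun p : Hol (Ux U) × Hol (Uy U) => B p.1 p.2) : Oq hq U →L[ℂ] H :=
  let T : Oq hq U →ₗ[ℂ] H :=
    { toFun := fun f => ∑' n, B (f.1.coeff n) (coord (Uy U) ^ n)
      map_add' := fun f g => by
        rw [← (summable_lift hq h0 hB f).tsum_add (summable_lift hq h0 hB g)]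
        refine tsum_congr fun n => ?_
        change B (f.1.coeff n + g.1.coeff n) _ = _
        rw [map_add, LinearMap.add_apply]
      map_smul' := fun c f => by
        rw [RingHom.id_apply, ← (summable_lift hq h0 hB f).tsum_const_smul c]
        refine tsum_congr fun n => ?_
        change B (c • f.1.coeff n) _ = _
        rw [map_smul, LinearMap.smul_apply] }
  ⟨T, by
    refine (PolynormableSpace.withSeminorms ℂ H).continuous_of_continuous_comp T fun s => ?_
    obtain ⟨K, ρ, C, hC, h⟩ := exists_summable_lift_le hq h0 hB s.2
    refine Seminorm.continuous_of_le (q := C.toNNReal • oqSeminorm hq U K ρ)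
      ((continuous_oqSeminorm hq K ρ).const_smul _) fun f => ?_
    have hs : Summable fun n => s.1 (B (f.1.coeff n) (coord (Uy U) ^ n)) :=
      Summable.of_nonneg_of_le (fun n => apply_nonneg s.1 _) (h f) ((f.2 K ρ).mul_left C)
    refine (seminorm_le_tsum s.2 (summable_lift hq h0 hB f).hasSum hs).trans ?_
    refine (hs.tsum_le_tsum (h f) ((f.2 K ρ).mul_left C)).trans_eq ?_
    rw [tsum_mul_left, ← oqSeminorm_apply]
    change _ = (C.toNNReal : ℝ) * _
    rw [Real.coe_toNNReal C hC]⟩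

theorem lift_monomial (h0 : (0 : ℂ) ∈ Ux U)
    (hB : Continuous fun p : Hol (Ux U) × Hol (Uy U) => B p.1 p.2) (n : ℕ) (a : Hol (Ux U)) :
    lift hq h0 hB (monomial hq U n a) = B a (coord (Uy U) ^ n) := by
  change ∑' m, B ((monomial hq U n a).1.coeff m) (coord (Uy U) ^ m) = _
  rw [tsum_eq_single n]
  · rw [coeff_monomial, if_pos rfl]
  · intro m hm
    rw [coeff_monomial, if_neg hm, map_zero, LinearMap.zero_apply]

theorem continuous_mulMap :
    Continuous fun p : Hol (Ux U) × Hol (Uy U) => mulMap (iotaX hq U) (iotaY hq U) p.1 p.2 :=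
  ((continuous_iotaX hq).comp continuous_fst).mul ((continuous_iotaY hq).comp continuous_snd)

/-- The lift is unique because the monomials `a(x) yⁿ`, which are the images of the pairs `(a, yⁿ)`,
span a dense subspace. If `U` is empty, all the spaces are zero. -/
theorem isCompletedProjectiveTensor_oq :
    IsCompletedProjectiveTensor.{u} (mulMap (iotaX hq U) (iotaY hq U)) where
  continuous := continuous_mulMap hq
  existsUnique_lift := by
    intro H _ _ _ _ _ _ _ _ B hB
    by_cases h0 : (0 : ℂ) ∈ Ux U
    · refine ⟨lift hq h0 hB, fun a b => ?_, fun T hT => ?_⟩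
      · refine eq_of_coord_pow hq (B := (mulMap (iotaX hq U) (iotaY hq U)).compr₂
          (lift hq h0 hB).toLinearMap) h0 ((lift hq h0 hB).continuous.comp (continuous_mulMap hq))
          hB (fun a n => ?_) a b
        change lift hq h0 hB (mulMap (iotaX hq U) (iotaY hq U) a (coord (Uy U) ^ n)) = _
        rw [mulMap_coord_pow hq h0, lift_monomial]
      · refine ContinuousLinearMap.ext fun f => ?_
        have hf := hasSum_monomial hq f
        refine (hf.map T T.continuous).unique
          ((hf.map (lift hq h0 hB) (lift hq h0 hB).continuous).congr_fun fun n => ?_)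
        change T (monomial hq U n (f.1.coeff n)) = lift hq h0 hB (monomial hq U n (f.1.coeff n))
        rw [lift_monomial, ← mulMap_coord_pow hq h0, hT]
    · have := subsingleton_hol_Ux h0
      have := subsingleton_oq hq h0
      refine ⟨0, fun a b => ?_, fun T _ => ContinuousLinearMap.ext fun f => ?_⟩
      · rw [Subsingleton.elim a 0, map_zero B]
        rfl
      · rw [Subsingleton.elim f 0, map_zero, map_zero]

end Oq

end QPlaneSheaf

end

theorem theorem5p1 (q : ℂ) (hq0 : q ≠ 0) (hq : ‖q‖ < 1)
    (U : Opens (QPlane q)) :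
    IsFrechetAlgebra (Oq hq U) ∧
    (∃ (ιx : Hol (Ux U) →ₐ[ℂ] Oq hq U) (ιy : Hol (Uy U) →ₐ[ℂ] Oq hq U),
      -- `ιx a` is the series `a(x) y⁰`, and `ιy b` is the Taylor series of `b` in `y`
      (∀ (a : Hol (Ux U)) (n : ℕ), (ιx a).1.coeff n = if n = 0 then a else 0) ∧
      (∀ b : Hol (Uy U), ∃ c : ℕ → ℂ,
        (∀ w : Uy U, HasSum (fun n => c n * (w : ℂ) ^ n) (b.1 w)) ∧
        ∀ n, (ιy b).1.coeff n = algebraMap ℂ (Hol (Ux U)) (c n)) ∧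
      -- `𝒪_q(U)` is the completed projective tensor product of `𝒪(U_x)` and `𝒪(U_y)`
      IsCompletedProjectiveTensor.{u} (mulMap ιx ιy) ∧
      -- the topological direct sum decomposition into closed subalgebras
      IsClosed (Set.range ιx) ∧
      IsClosed (Ring.jacobson (Oq hq U) : Set (Oq hq U)) ∧
      IsClosed (ιy '' (holVanish (Uy U) : Set (Hol (Uy U)))) ∧
      ∃ e : (Hol (Ux U) × Ring.jacobson (Oq hq U) × holVanish (Uy U)) ≃L[ℂ] Oq hq U,
        ∀ a r b, e (a, r, b) = ιx a + r.1 + ιy b.1) ∧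
    -- the radical consists of the series `∑_{n ≥ 1} fₙ(x) yⁿ` with `fₙ(0) = 0`
    (∀ f : Oq hq U, f ∈ Ring.jacobson (Oq hq U) ↔
      f.1.coeff 0 = 0 ∧ ∀ n : ℕ, 1 ≤ n → f.1.coeff n ∈ holVanish (Ux U)) ∧
    -- commutativity modulo the radical
    (∀ f g : Oq hq U, f * g - g * f ∈ Ring.jacobson (Oq hq U)) ∧
    -- `Spec 𝒪_q(U) = U`: the continuous characters are the evaluations at the points of `U`
    ∃ ev : U ≃ (Oq hq U →A[ℂ] ℂ), ∀ (γ : U) (f : Oq hq U),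
      HasSum (fun n => (f.1.coeff n).1 ⟨γ.1.1.1, fst_mem_Ux U γ⟩ * γ.1.1.2 ^ n) (ev γ f) := by
  refine ⟨isFrechetAlgebra_oq hq U, ⟨iotaX hq U, iotaY hq U, coeff_monomial hq 0,
    fun b => ⟨taylorCoeff b, hasSum_taylorCoeff b, fun n => rfl⟩,
    isCompletedProjectiveTensor_oq hq, isClosed_range_iotaX hq, ?_⟩,
    mem_jacobson_oq_iff_coeff hq, commutator_mem_jacobson_oq hq, exists_spectrum_equiv hq⟩
  by_cases h0 : (0 : ℂ) ∈ Ux U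
  · exact ⟨isClosed_jacobson_oq hq h0, isClosed_image_iotaY hq h0, decomposition hq h0,
      fun a r b => rfl⟩
  · have := subsingleton_hol_Ux h0
    have := subsingleton_hol_Uy h0
    have := subsingleton_oq hq h0
    exact ⟨Set.subsingleton_of_subsingleton.isClosed, Set.subsingleton_of_subsingleton.isClosed,
      ⟨0, continuous_const, continuous_const⟩, fun a r b => Subsingleton.elim _ _⟩
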